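/- Let $d\ge 0$ be an integer, $T\ge 0$, $\mathbb{T}^d=\mathbb{R}^d/\mathbb{Z}^d$, and let $\mathcal{P}^1(X)$ denote the Borel probabilities with finite first moment on a metric space $X$, with the Kantorovich–Rubinstein (1-Wasserstein) metric $W_1(m_1,m_2)=\sup\{\int\varphi\,dm_1-\int\varphi\,dm_2:\varphi \text{ is } 1\text{-Lipschitz}\}$. Let $U$ be a nonempty compact metric space, and let $f:[0,T]\times\mathbb{T}^d\times\mathcal{P}^1(\mathbb{T}^d)\times U\to\mathbb{R}^d$, $g:[0,T]\times\mathbb{T}^d\times\mathcal{P}^1(\mathbb{T}^d)\times U\to\mathbb{R}$ and $\sigma:\mathbb{T}^d\times\mathcal{P}^1(\mathbb{T}^d)\to\mathbb{R}$ be continuous, such that: (i) there is $\alpha:\mathbb{R}\to[0,\infty)$ with $\alpha(\delta)\to0$ as $\delta\to0$ and $\|f(t',x,m,u)-f(t'',x,m,u)\|\le\alpha(t'-t'')$, $|g(t',x,m,u)-g(t'',x,m,u)|\le\alpha(t'-t'')$; (ii) there is $L$ such that $\|f(t,x',m',u)-f(t,x'',m'',u)\|$ and $|g(t,x',m',u)-g(t,x'',m'',u)|$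 are at most $L(\|x'-x''\|+W_1(m',m''))$; (iii) there is $\varkappa$ such that $|\sigma(x',m)-\sigma(x'',m)|\le\varkappa\|x'-x''\|$ (for all values of the arguments). Put $F(t,x,m)=\mathrm{co}\{(f(t,x,m,u),g(t,x,m,u)):u\in U\}$. For $s\le r$ in $[0,T]$ and a measurable $m:[s,r]\to\mathcal{P}^1(\mathbb{T}^d)$, let $\mathrm{SOL}(r,s,m(\cdot))\subset C([s,r],\mathbb{T}^d\times\mathbb{R})$ be the set of (absolutely continuous) solutions $(x(\cdot),z(\cdot))$ of $(\dot x(t),\dot z(t))\in F(t,x(t),m(t))$ for a.e. $t\in[s,r]$, and let $\mathrm{Sol}(r,s,y,m(\cdot))$ be the set of those with $x(s)=y$. A solution of the mean field game on $[t_0,T]$ is a pair $(V,m(\cdot))$ of a continuous $V:[t_0,T]\times\mathbb{T}^d\to\mathbb{R}$ and a measurable $m:[t_0,T]\to\mathcal{P}^1(\mathbb{T}^d)$ for which there is $\chi\in\mathcal{P}^1(C([t_0,T],\mathbb{T}^d\times\mathbb{R}))$ such that 1. $m(t)$ is the law of $x(t)$ under $\chi$, for all $t\in[t_0,T]$; 2.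 $V(s,y)=\sup\{\sigma(x(T),m(T))+z(T)-z(s):(x(\cdot),z(\cdot))\in\mathrm{Sol}(T,s,y,m(\cdot))\}$ for all $s\in[t_0,T]$, $y\in\mathbb{T}^d$; 3. $\mathrm{supp}(\chi)\subset\mathrm{SOL}(T,t_0,m(\cdot))$; 4. $V(s,x(s))+z(s)=V(r,x(r))+z(r)$ for all $s<r$ in $[t_0,T]$ and all $(x(\cdot),z(\cdot))\in\mathrm{supp}(\chi)$. A multifunction $\mathcal{V}:[0,T]\times\mathcal{P}^1(\mathbb{T}^d)\rightrightarrows C(\mathbb{T}^d)$ (values may be empty) is called realized if for all $t_0\in[0,T]$, $m_0\in\mathcal{P}^1(\mathbb{T}^d)$ and $\phi\in\mathcal{V}(t_0,m_0)$ there is a solution $(V,m(\cdot))$ of the mean field game on $[t_0,T]$ with $V(t_0,\cdot)=\phi$ and $m(t_0)=m_0$. It is called upper semicontinuous if its graph is closed and, for every $(t_0,m_0)$ and every open $O\supset\mathcal{V}(t_0,m_0)$, one has $\mathcal{V}(t,m)\subset O$ for all $(t,m)$ sufficiently close to $(t_0,m_0)$. It is called a value multifunction if it is upper semicontinuous and realized.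 **Proposition.** Let $\mathcal{V}:[0,T]\times\mathcal{P}^1(\mathbb{T}^d)\rightrightarrows C(\mathbb{T}^d)$ be realized. Define its closure $\mathcal{V}^\natural$ by: $\phi\in\mathcal{V}^\natural(t_0,m_0)$ if and only if there are sequences $t_i\in[0,T]$, $m_i\in\mathcal{P}^1(\mathbb{T}^d)$, $\phi_i\in\mathcal{V}(t_i,m_i)$ with $t_i\to t_0$, $W_1(m_i,m_0)\to0$ and $\|\phi_i-\phi\|\to0$. Then $\mathcal{V}^\natural$ is a value multifunction; that is, $\mathcal{V}^\natural$ is upper semicontinuous and realized. -/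

import Mathlib

open Set Filter Topology MeasureTheory
open scoped NNReal

noncomputable section

namespace MFG

/-! ### Probabilities with finite first moment and the Kantorovich–Rubinstein metric -/

/-- Borel probabilities on a metric space `X` with finite first moment. -/
structure P1 (X : Type*) [MetricSpace X] [MeasurableSpace X] where
  /-- the underlying probability -/
  prob : ProbabilityMeasure X
  /-- finiteness of the first moment -/
  moment : ∃ x₀ : X, Integrable (fun x => dist x x₀) (prob : Measure X)

namespace P1

variable {X : Type*} [MetricSpace X] [MeasurableSpace X]

/-- The measure underlying an element of `P1 X`. -/
def measure (m : P1 X) : Measure X := (m.prob : Measure X)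

instance (m : P1 X) : IsProbabilityMeasure m.measure :=
  inferInstanceAs (IsProbabilityMeasure (m.prob : Measure X))

theorem ext_measure {m₁ m₂ : P1 X} (h : m₁.measure = m₂.measure) : m₁ = m₂ := by
  cases m₁; cases m₂
  congr
  exact Subtype.ext h

/-- The numbers `∫ φ dm₁ - ∫ φ dm₂`, with `φ` a `1`-Lipschitz function. -/
def lipDiff (m₁ m₂ : P1 X) : Set ℝ :=
  {r | ∃ φ : X → ℝ, LipschitzWith 1 φ ∧ r = (∫ x, φ x ∂m₁.measure) - ∫ x, φ x ∂m₂.measure}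

/-- The Kantorovich–Rubinstein (1-Wasserstein) distance
`W₁(m₁, m₂) = sup {∫ φ dm₁ - ∫ φ dm₂ : φ ∈ Lip₁(X)}`. -/
def W1 (m₁ m₂ : P1 X) : ℝ := sSup (lipDiff m₁ m₂)

theorem W1_le {m₁ m₂ : P1 X} {C : ℝ} (h : ∀ φ : X → ℝ, LipschitzWith 1 φ →
    (∫ x, φ x ∂m₁.measure) - ∫ x, φ x ∂m₂.measure ≤ C) : W1 m₁ m₂ ≤ C := by
  refine csSup_le ⟨0, fun _ => 0, LipschitzWith.const' 0, by simp⟩ ?_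
  rintro r ⟨φ, hφ, rfl⟩
  exact h φ hφ

section Metric

variable [BorelSpace X]

theorem integrable_dist (m : P1 X) (x₀ : X) : Integrable (fun x => dist x x₀) m.measure := by
  obtain ⟨y, hy⟩ := m.moment
  have hy' : Integrable (fun x => dist x y) m.measure := hy
  refine (hy'.add (integrable_const (dist y x₀))).mono'
    (by fun_prop : Continuous fun x : X => dist x x₀).measurable.aestronglyMeasurable ?_
  filter_upwards with x
  rw [Real.norm_of_nonneg dist_nonneg]
  exact dist_triangle _ _ _

theorem integrable_lip (m : P1 X) {K : ℝ≥0} {φ : X → ℝ} (hφ : LipschitzWith K φ) :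
    Integrable φ m.measure := by
  obtain ⟨y, -⟩ := m.moment
  refine (((m.integrable_dist y).const_mul (K : ℝ)).add (integrable_const |φ y|)).mono'
    hφ.continuous.measurable.aestronglyMeasurable ?_
  filter_upwards with x
  have h := hφ.dist_le_mul x y
  rw [Real.dist_eq] at h
  have h2 := abs_sub_abs_le_abs_sub (φ x) (φ y)
  simp only [Pi.add_apply, Real.norm_eq_abs]
  linarith

theorem bddAbove_lipDiff (m₁ m₂ : P1 X) : BddAbove (lipDiff m₁ m₂) := by
  obtain ⟨y, -⟩ := m₁.moment
  refine ⟨(∫ x, dist x y ∂m₁.measure) + ∫ x, dist x y ∂m₂.measure, ?_⟩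
  rintro r ⟨φ, hφ, rfl⟩
  have hb : ∀ x, |φ x - φ y| ≤ dist x y := fun x => by
    simpa [Real.dist_eq] using hφ.dist_le_mul x y
  have h1 : (∫ x, φ x ∂m₁.measure) ≤ ∫ x, (dist x y + φ y) ∂m₁.measure := by
    refine integral_mono (m₁.integrable_lip hφ)
      ((m₁.integrable_dist y).add (integrable_const _)) fun x => ?_
    have := (abs_le.1 (hb x)).2
    show φ x ≤ dist x y + φ y
    linarith
  have h2 : (∫ x, (φ y - dist x y) ∂m₂.measure) ≤ ∫ x, φ x ∂m₂.measure := by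
    refine integral_mono ((integrable_const _).sub (m₂.integrable_dist y))
      (m₂.integrable_lip hφ) fun x => ?_
    have := (abs_le.1 (hb x)).1
    show φ y - dist x y ≤ φ x
    linarith
  rw [integral_add (m₁.integrable_dist y) (integrable_const _)] at h1
  rw [integral_sub (integrable_const _) (m₂.integrable_dist y)] at h2
  simp at h1 h2
  linarith

theorem le_W1 (m₁ m₂ : P1 X) {φ : X → ℝ} (hφ : LipschitzWith 1 φ) :
    (∫ x, φ x ∂m₁.measure) - ∫ x, φ x ∂m₂.measure ≤ W1 m₁ m₂ :=
  le_csSup (bddAbove_lipDiff m₁ m₂) ⟨φ, hφ, rfl⟩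

theorem W1_comm_le (m₁ m₂ : P1 X) : W1 m₁ m₂ ≤ W1 m₂ m₁ := by
  refine W1_le fun φ hφ => ?_
  have h := le_W1 m₂ m₁ (φ := fun x => -φ x) hφ.neg
  rw [integral_neg, integral_neg] at h
  linarith

theorem eq_of_W1_eq_zero {m₁ m₂ : P1 X} (h : W1 m₁ m₂ = 0) : m₁ = m₂ := by
  have key : ∀ φ : X → ℝ, LipschitzWith 1 φ →
      (∫ x, φ x ∂m₁.measure) = ∫ x, φ x ∂m₂.measure := by
    intro φ hφ
    have a := le_W1 m₁ m₂ hφ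
    have b := (le_W1 m₂ m₁ hφ).trans (W1_comm_le m₂ m₁)
    linarith
  have key' : ∀ (K : ℝ≥0) (φ : X → ℝ), LipschitzWith K φ →
      (∫ x, φ x ∂m₁.measure) = ∫ x, φ x ∂m₂.measure := by
    intro K φ hφ
    have hK : (0 : ℝ) < K + 1 := by positivity
    have hl : LipschitzWith 1 (fun x => ((K : ℝ) + 1)⁻¹ * φ x) := by
      refine LipschitzWith.of_dist_le_mul fun x y => ?_
      have h1 := hφ.dist_le_mul x y
      rw [Real.dist_eq] at h1 ⊢
      rw [← mul_sub, abs_mul, abs_of_pos (inv_pos.2 hK), inv_mul_le_iff₀ hK]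
      have := dist_nonneg (x := x) (y := y)
      simp only [NNReal.coe_one, one_mul]
      nlinarith
    have h2 := key _ hl
    rw [integral_const_mul, integral_const_mul] at h2
    exact mul_left_cancel₀ (inv_pos.2 hK).ne' h2
  have hp : m₁.prob = m₂.prob := by
    have ht : Tendsto (fun _ : ℕ => m₁.prob) atTop (𝓝 m₂.prob) := by
      rw [tendsto_iff_forall_lipschitz_integral_tendsto]
      rintro φ - ⟨K, hK⟩
      have := key' K φ hK
      unfold measure at this
      rw [this]
      exact tendsto_const_nhds
    exact tendsto_nhds_unique tendsto_const_nhds ht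
  exact ext_measure (congrArg (fun p : ProbabilityMeasure X => (p : Measure X)) hp)

/-- `P1 X` is endowed with the Kantorovich–Rubinstein metric. -/
instance : MetricSpace (P1 X) where
  dist := W1
  dist_self m := le_antisymm (W1_le fun φ _ => by simp)
    (by simpa using le_W1 m m (φ := fun _ => 0) (LipschitzWith.const' 0))
  dist_comm m₁ m₂ := le_antisymm (W1_comm_le _ _) (W1_comm_le _ _)
  dist_triangle m₁ m₂ m₃ := W1_le fun φ hφ => by
    have a := le_W1 m₁ m₂ hφ
    have b := le_W1 m₂ m₃ hφ
    linarith
  eq_of_dist_eq_zero h := eq_of_W1_eq_zero h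

/-- The Borel `σ`-algebra of the Kantorovich–Rubinstein metric. -/
instance : MeasurableSpace (P1 X) := borel (P1 X)

instance : BorelSpace (P1 X) := ⟨rfl⟩

end Metric

end P1

/-! ### State space and motions -/

/-- The `d`-dimensional torus `ℝᵈ / ℤᵈ`. -/
abbrev Torus (d : ℕ) : Type := UnitAddTorus (Fin d)

/-- The natural projection `ℝᵈ → ℝᵈ / ℤᵈ`. -/
def toTorus {d : ℕ} (x : Fin d → ℝ) : Torus d := fun i => (x i : UnitAddCircle)

/-- Motions on `[s, r]` in the extended phase space `𝕋ᵈ × ℝ`. -/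
abbrev Motion (d : ℕ) (s r : ℝ) : Type := C(Icc s r, Torus d × ℝ)

instance (d : ℕ) (s r : ℝ) : MeasurableSpace (Motion d s r) := borel (Motion d s r)

instance (d : ℕ) (s r : ℝ) : BorelSpace (Motion d s r) := ⟨rfl⟩

section Game

variable {d : ℕ} {U : Type*}

/-- Regularity assumptions on the dynamics `f`, the running payoff `g` and the terminal
payoff `σ` of a mean field game on `[0, T]`. -/
structure Assumptions [MetricSpace U] (T : ℝ)
    (f : ℝ → Torus d → P1 (Torus d) → U → (Fin d → ℝ))
    (g : ℝ → Torus d → P1 (Torus d) → U → ℝ)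
    (σ : Torus d → P1 (Torus d) → ℝ) : Prop where
  continuous_f : ContinuousOn
    (fun p : ℝ × Torus d × P1 (Torus d) × U => f p.1 p.2.1 p.2.2.1 p.2.2.2) (Icc 0 T ×ˢ univ)
  continuous_g : ContinuousOn
    (fun p : ℝ × Torus d × P1 (Torus d) × U => g p.1 p.2.1 p.2.2.1 p.2.2.2) (Icc 0 T ×ˢ univ)
  continuous_σ : Continuous fun p : Torus d × P1 (Torus d) => σ p.1 p.2
  modulus : ∃ α : ℝ → ℝ, (∀ δ, 0 ≤ α δ) ∧ Tendsto α (𝓝[≠] 0) (𝓝 0) ∧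
    ∀ t' ∈ Icc 0 T, ∀ t'' ∈ Icc 0 T, ∀ x m u,
      ‖f t' x m u - f t'' x m u‖ ≤ α (t' - t'') ∧ |g t' x m u - g t'' x m u| ≤ α (t' - t'')
  lipschitz : ∃ L : ℝ, ∀ t ∈ Icc 0 T, ∀ x' x'' m' m'' u,
    ‖f t x' m' u - f t x'' m'' u‖ ≤ L * (‖x' - x''‖ + P1.W1 m' m'') ∧
    |g t x' m' u - g t x'' m'' u| ≤ L * (‖x' - x''‖ + P1.W1 m' m'')
  lipschitz_σ : ∃ ϰ : ℝ, ∀ x' x'' m, |σ x' m - σ x'' m| ≤ ϰ * ‖x' - x''‖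

variable (f : ℝ → Torus d → P1 (Torus d) → U → (Fin d → ℝ))
  (g : ℝ → Torus d → P1 (Torus d) → U → ℝ)
  (σ : Torus d → P1 (Torus d) → ℝ)

/-- The vectogram `F(t, x, m) = co {(f(t, x, m, u), g(t, x, m, u)) : u ∈ U}`. -/
def vectogram (t : ℝ) (x : Torus d) (m : P1 (Torus d)) : Set ((Fin d → ℝ) × ℝ) :=
  convexHull ℝ (range fun u : U => (f t x m u, g t x m u))

/-- `SOL(r, s, m(·))`: the motions `w = (x, z)` on `[s, r]` that solve the differential inclusion
`(ẋ(t), ż(t)) ∈ F(t, x(t), m(t))`, i.e. that are indefinite integrals (on the torus, modulo `ℤᵈ`)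
of an integrable velocity which lies in `F(t, x(t), m(t))` for almost every `t ∈ [s, r]`. -/
def SOL (m : ℝ → P1 (Torus d)) {s r : ℝ} (hsr : s ≤ r) : Set (Motion d s r) :=
  {w | ∃ v : ℝ → (Fin d → ℝ) × ℝ, IntegrableOn v (Icc s r) ∧
    (∀ᵐ t : ℝ, ∀ ht : t ∈ Icc s r, v t ∈ vectogram f g t (w ⟨t, ht⟩).1 (m t)) ∧
    ∀ t : Icc s r,
      (w t).1 = (w ⟨s, left_mem_Icc.2 hsr⟩).1 + toTorus (∫ τ in s..(t : ℝ), (v τ).1) ∧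
      (w t).2 = (w ⟨s, left_mem_Icc.2 hsr⟩).2 + ∫ τ in s..(t : ℝ), (v τ).2}

/-- `Sol(r, s, y, m(·))`: the elements of `SOL(r, s, m(·))` with `x(s) = y`. -/
def Sol (m : ℝ → P1 (Torus d)) {s r : ℝ} (hsr : s ≤ r) (y : Torus d) : Set (Motion d s r) :=
  {w | w ∈ SOL f g m hsr ∧ (w ⟨s, left_mem_Icc.2 hsr⟩).1 = y}

/-- `(V, m(·))` is a solution on `[t₀, T]` of the mean field game. Only the values of `V` and `m`
at times in `[t₀, T]` matter. -/
def IsSolution (T t₀ : ℝ) (ht₀ : t₀ ≤ T) (V : ℝ → Torus d → ℝ) (m : ℝ → P1 (Torus d)) : Prop :=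
  ContinuousOn (fun p : ℝ × Torus d => V p.1 p.2) (Icc t₀ T ×ˢ univ) ∧
  Measurable (fun t : Icc t₀ T => m t) ∧
  ∃ χ : P1 (Motion d t₀ T),
    (∀ t : Icc t₀ T, (m t).measure = χ.measure.map fun w => (w t).1) ∧
    (∀ (s : ℝ) (hs : s ∈ Icc t₀ T) (y : Torus d),
      IsLUB ((fun w : Motion d s T =>
          σ (w ⟨T, right_mem_Icc.2 hs.2⟩).1 (m T) + (w ⟨T, right_mem_Icc.2 hs.2⟩).2
            - (w ⟨s, left_mem_Icc.2 hs.2⟩).2) '' Sol f g m hs.2 y)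
        (V s y)) ∧
    χ.measure.support ⊆ SOL f g m ht₀ ∧
    ∀ s r : Icc t₀ T, s < r → ∀ w ∈ χ.measure.support,
      V s (w s).1 + (w s).2 = V r (w r).1 + (w r).2

/-! ### Value multifunctions -/

/-- Every `φ ∈ 𝒱(t₀, m₀)` is `V(t₀, ·)` for a solution `(V, m(·))` with `m(t₀) = m₀`. -/
def IsRealized (T : ℝ) (𝒱 : Icc (0 : ℝ) T × P1 (Torus d) → Set C(Torus d, ℝ)) : Prop :=
  ∀ (t₀ : Icc (0 : ℝ) T) (m₀ : P1 (Torus d)), ∀ φ ∈ 𝒱 (t₀, m₀),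
    ∃ (V : ℝ → Torus d → ℝ) (m : ℝ → P1 (Torus d)),
      IsSolution f g σ T t₀ t₀.2.2 V m ∧ (∀ x, V t₀ x = φ x) ∧ m t₀ = m₀

/-- Upper semicontinuity of a multifunction, in both usual senses: the graph is closed, and
for every open `O ⊇ 𝒱(p)` one has `𝒱(q) ⊆ O` for all `q` close to `p`. -/
def IsUSC {P Y : Type*} [TopologicalSpace P] [TopologicalSpace Y] (𝒱 : P → Set Y) : Prop :=
  UpperHemicontinuous 𝒱 ∧ IsClosed {q : P × Y | q.2 ∈ 𝒱 q.1}

/-- Value multifunctions of the mean field game. -/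
def IsValueMultifunction (T : ℝ) (𝒱 : Icc (0 : ℝ) T × P1 (Torus d) → Set C(Torus d, ℝ)) : Prop :=
  IsUSC 𝒱 ∧ IsRealized f g σ T 𝒱

end Game

/-- The closure `𝒱♮` of a multifunction. -/
def closureMultifunction {d : ℕ} {T : ℝ}
    (𝒱 : Icc (0 : ℝ) T × P1 (Torus d) → Set C(Torus d, ℝ)) :
    Icc (0 : ℝ) T × P1 (Torus d) → Set C(Torus d, ℝ) := fun p =>
  {φ | ∃ (t : ℕ → Icc (0 : ℝ) T) (m : ℕ → P1 (Torus d)) (ψ : ℕ → C(Torus d, ℝ)),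
    (∀ i, ψ i ∈ 𝒱 (t i, m i)) ∧ Tendsto t atTop (𝓝 p.1) ∧ Tendsto m atTop (𝓝 p.2) ∧
    Tendsto (fun i => ‖ψ i - φ‖) atTop (𝓝 0)}

end MFG

end

/-! Everything rests on compactness of the set of solutions (`exists_subseq_isSolution`): solutions
on `[ti, T]` with `ti → t₀` have a subsequence whose initial distributions and initial value
functions converge to those of a solution on `[t₀, T]`. Granted this, an element of the closure is a
limit of realized functions, hence realized. The graph of the closure is a closure, hence closed. A
sequence violating the neighbourhood form of upper semicontinuity would have a subsequence
converging into the value at the limit point, a contradiction.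

For compactness, a solution is encoded by its law `χ` on motions (`IsEquilibrium`); the flow and the
value function are recovered from `χ`. All admissible motions are `M`-Lipschitz. Freezing them
before their initial time and normalizing `z` places them in one Arzelà–Ascoli compact set, so the
transferred laws have a `W1`-convergent subsequence (`exists_subseq_transfer`) and the flows
converge uniformly.

It remains to show that a limit of equilibria is an equilibrium (`IsEquilibrium.of_tendsto`). Each
motion in the support of the limit law is a limit of motions in the approximating supports. Such
limits solve the limiting inclusion because the vectogram is convex, compact and continuous in time,
state and distribution (`VectogramBounds.mem_SOL_of_tendsto`). The identity for `V + z` passes to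
the limit because value functions converge uniformly. That convergence comes from a Filippov theorem
(`IsTame.exists_isTraj_near`): a trajectory for one flow is shadowed by a trajectory for a nearby
flow, initial time and initial state, which makes the value function Lipschitz in the last three
apart from the terminal payoff (`value_le_value_add`).

Inclusions are studied on the cover `ℝᵈ × ℝ` through increments (`IsTraj`), a condition stable under
pointwise limits and equivalent to being an integral curve for tame fields. -/

noncomputable section

namespace MFG

/-! ### Differential inclusions with convex compact values: integral curves and increments. -/

section Inclusion

theorem mem_cthickening_iff_exists_norm_le {E : Type*} [NormedAddCommGroup E] {A : Set E}
    (hA : IsCompact A) {ε : ℝ} (hε : 0 ≤ ε) {u : E} : u ∈ Metric.cthickening ε A ↔ ∃ v ∈ A, ‖u - v‖ ≤ ε := by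
  simp [hA.cthickening_eq_biUnion_closedBall hε, dist_eq_norm]

variable {E : Type*} [NormedAddCommGroup E] [NormedSpace ℝ E]

/-- The convex hull of a compact set in a finite-dimensional space is compact. -/
theorem isCompact_convexHull [FiniteDimensional ℝ E] {s : Set E} (hs : IsCompact s) :
    IsCompact (convexHull ℝ s) := by
  -- Carathéodory: at most `finrank + 1` points are needed, so the hull is a finite union of
  -- continuous images of compact sets.
  have key : convexHull ℝ s = ⋃ k ∈ Finset.range (Module.finrank ℝ E + 2),
      (fun p : (Fin k → ℝ) × (Fin k → E) => ∑ i, p.1 i • p.2 i) ''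
        (stdSimplex ℝ (Fin k) ×ˢ univ.pi fun _ => s) := by
    apply Subset.antisymm
    · intro x hx
      obtain ⟨ι, _, z, w, hz, hind, hw, hsum, rfl⟩ := eq_pos_convex_span_of_mem_convexHull hx
      have hcard : Fintype.card ι ≤ Module.finrank ℝ E + 1 :=
        hind.card_le_finrank_succ.trans (Nat.succ_le_succ (Submodule.finrank_le _))
      let e := Fintype.equivFin ι
      refine mem_iUnion₂.2 ⟨Fintype.card ι, Finset.mem_range.2 (by omega),
        ⟨w ∘ e.symm, z ∘ e.symm⟩, ⟨⟨fun i => (hw _).le, ?_⟩, fun i _ => hz ⟨_, rfl⟩⟩, ?_⟩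
      · rw [← hsum]
        exact e.symm.sum_comp w
      · exact e.symm.sum_comp fun i => w i • z i
    · refine iUnion₂_subset fun k _ => ?_
      rintro _ ⟨⟨w, z⟩, ⟨⟨hw, hsum⟩, hz⟩, rfl⟩
      exact (convex_convexHull ℝ s).sum_mem (fun i _ => hw i) hsum
        fun i _ => subset_convexHull ℝ s (hz i (mem_univ i))
  rw [key]
  refine (Finset.range _).isCompact_biUnion fun k _ => ?_
  exact ((isCompact_stdSimplex ℝ (Fin k)).prod (isCompact_univ_pi fun _ => hs)).image
    (by fun_prop)

/-- A set-valued field on `[0, T] × E` with compact convex nonempty values in the ball of radius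
`M`, whose excess is controlled by `ε + L ‖ξ - ξ'‖` at times at distance at most `δ ε`. -/
structure IsTame (T M L : ℝ) (δ : ℝ → ℝ) (G : ℝ → E → Set E) : Prop where
  M_nonneg : 0 ≤ M
  L_nonneg : 0 ≤ L
  δ_pos : ∀ ε > 0, 0 < δ ε
  convex : ∀ t ∈ Icc 0 T, ∀ ξ, Convex ℝ (G t ξ)
  compact : ∀ t ∈ Icc 0 T, ∀ ξ, IsCompact (G t ξ)
  nonempty : ∀ t ∈ Icc 0 T, ∀ ξ, (G t ξ).Nonempty
  norm_le : ∀ t ∈ Icc 0 T, ∀ ξ, ∀ v ∈ G t ξ, ‖v‖ ≤ M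
  near : ∀ ε > 0, ∀ t ∈ Icc 0 T, ∀ t' ∈ Icc 0 T, |t - t'| ≤ δ ε → ∀ ξ ξ', ∀ v ∈ G t ξ,
    ∃ v' ∈ G t' ξ', ‖v - v'‖ ≤ ε + L * ‖ξ - ξ'‖

/-- Increments of `W` over intervals in `(s, T]` of length at most `η ε` are `ε`-close, relatively to
the length, to a velocity admissible at the left endpoint. -/
structure IsTraj (G : ℝ → E → Set E) (M s T : ℝ) (W : ℝ → E) : Prop where
  lip : ∀ a ∈ Icc s T, ∀ b ∈ Icc s T, ‖W b - W a‖ ≤ M * |b - a|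
  slope : ∀ ε > 0, ∃ η > 0, ∀ a b, s < a → a ≤ b → b ≤ T → b - a ≤ η →
    ∃ v ∈ G a (W a), ‖W b - W a - (b - a) • v‖ ≤ ε * (b - a)

/-- The step size that works simultaneously for all solutions of a tame inclusion. -/
def stepSize (M L : ℝ) (δ : ℝ → ℝ) (ε : ℝ) : ℝ := min (δ (ε / 2)) (ε / (2 * (L * M + 1)))

variable {T M L s : ℝ} {δ : ℝ → ℝ} {G : ℝ → E → Set E} {W : ℝ → E}

theorem IsTame.stepSize_pos (hG : IsTame T M L δ G) {ε : ℝ} (hε : 0 < ε) :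
    0 < stepSize M L δ ε := by
  have := mul_nonneg hG.L_nonneg hG.M_nonneg
  exact lt_min (hG.δ_pos _ (half_pos hε)) (by positivity)

/-- Over a time `h` an `M`-Lipschitz curve moves by at most `M * h`. The two terms of `stepSize`
allot `ε / 2` to the change of time and `ε / 2` to the change of state. -/
theorem IsTame.near_of_le_stepSize (hG : IsTame T M L δ G) {ε h : ℝ} (hε : 0 < ε)
    (hh : h ≤ stepSize M L δ ε) {t t' : ℝ} (ht : t ∈ Icc 0 T) (ht' : t' ∈ Icc 0 T)
    (htt : |t - t'| ≤ h) {ξ ξ' : E} (hξ : ‖ξ - ξ'‖ ≤ M * h) {v : E} (hv : v ∈ G t ξ) :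
    ∃ v' ∈ G t' ξ', ‖v - v'‖ ≤ ε := by
  obtain ⟨v', hv', h1⟩ := hG.near (ε / 2) (half_pos hε) t ht t' ht'
    (htt.trans (hh.trans (min_le_left _ _))) ξ ξ' v hv
  refine ⟨v', hv', h1.trans ?_⟩
  have hLM := mul_nonneg hG.L_nonneg hG.M_nonneg
  have h2 : h ≤ ε / (2 * (L * M + 1)) := hh.trans (min_le_right _ _)
  rw [le_div_iff₀ (by positivity)] at h2
  have h3 := mul_le_mul_of_nonneg_left hξ hG.L_nonneg
  have h0 : 0 ≤ h := (abs_nonneg _).trans htt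
  nlinarith

section Integral

variable {v : ℝ → E}

theorem norm_sub_le_of_integral (hv : IntegrableOn v (Icc s T))
    (hae : ∀ᵐ t : ℝ, t ∈ Icc s T → ‖v t‖ ≤ M)
    (hW : ∀ t ∈ Icc s T, W t = W s + ∫ τ in s..t, v τ) :
    (∀ a ∈ Icc s T, ∀ b ∈ Icc s T, W b - W a = ∫ τ in a..b, v τ) ∧
    ∀ a ∈ Icc s T, ∀ b ∈ Icc s T, ‖W b - W a‖ ≤ M * |b - a| := by
  have hint : ∀ a ∈ Icc s T, ∀ b ∈ Icc s T, IntervalIntegrable v volume a b := fun a ha b hb =>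
    (hv.mono_set (uIcc_subset_Icc ha hb)).intervalIntegrable
  have hsub : ∀ a ∈ Icc s T, ∀ b ∈ Icc s T, W b - W a = ∫ τ in a..b, v τ := by
    intro a ha b hb
    have hs : s ∈ Icc s T := ⟨le_rfl, ha.1.trans ha.2⟩
    rw [hW a ha, hW b hb, ← intervalIntegral.integral_interval_sub_left (hint s hs b hb)
      (hint s hs a ha)]
    abel
  refine ⟨hsub, fun a ha b hb => ?_⟩
  rw [hsub a ha b hb]
  refine intervalIntegral.norm_integral_le_of_norm_le_const_ae ?_
  filter_upwards [hae] with t ht hmem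
  exact ht (uIcc_subset_Icc ha hb (uIoc_subset_uIcc hmem))

/-- Integral curves satisfy the increment condition with the common step size. -/
theorem IsTame.slope_of_integral [CompleteSpace E] (hG : IsTame T M L δ G) (hs : 0 ≤ s)
    (hv : IntegrableOn v (Icc s T)) (hae : ∀ᵐ t : ℝ, t ∈ Icc s T → v t ∈ G t (W t))
    (hW : ∀ t ∈ Icc s T, W t = W s + ∫ τ in s..t, v τ) {ε : ℝ} (hε : 0 < ε) {a b : ℝ}
    (ha : s ≤ a) (hab : a ≤ b) (hb : b ≤ T) (hba : b - a ≤ stepSize M L δ ε) :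
    ∃ u ∈ G a (W a), ‖W b - W a - (b - a) • u‖ ≤ ε * (b - a) := by
  have h0 : Icc s T ⊆ Icc 0 T := Icc_subset_Icc_left hs
  have ha' : a ∈ Icc s T := ⟨ha, hab.trans hb⟩
  have hb' : b ∈ Icc s T := ⟨ha.trans hab, hb⟩
  have hbd : ∀ᵐ t : ℝ, t ∈ Icc s T → ‖v t‖ ≤ M := by
    filter_upwards [hae] with t ht hmem
    exact hG.norm_le t (h0 hmem) _ _ (ht hmem)
  obtain ⟨hsub, hlip⟩ := norm_sub_le_of_integral hv hbd hW
  rcases hab.eq_or_lt with rfl | hlt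
  · obtain ⟨u, hu⟩ := hG.nonempty a (h0 ha') (W a)
    exact ⟨u, hu, by simp⟩
  have hc := hG.compact a (h0 ha') (W a)
  have hsubset : Ioc a b ⊆ Icc s T := Ioc_subset_Icc_self.trans (Icc_subset_Icc ha hb)
  -- On `[a, b]` every velocity is within `ε` of `G a (W a)`; the closed thickening is convex, so it
  -- also contains the mean velocity.
  have hmem : (⨍ τ in Ioc a b, v τ) ∈ Metric.cthickening ε (G a (W a)) := by
    refine ((hG.convex a (h0 ha') (W a)).cthickening ε).set_average_mem
      Metric.isClosed_cthickening (by simp [hlt]) (by simp) ?_ (hv.mono_set hsubset)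
    rw [ae_restrict_iff' measurableSet_Ioc]
    filter_upwards [hae] with t ht htm
    rw [mem_cthickening_iff_exists_norm_le hc hε.le]
    have hd : |t - a| ≤ b - a := by
      rw [abs_of_nonneg (by linarith [htm.1])]
      linarith [htm.2]
    refine hG.near_of_le_stepSize hε hba (h0 (hsubset htm)) (h0 ha') hd
      ((hlip a ha' t (hsubset htm)).trans ?_) (ht (hsubset htm))
    exact mul_le_mul_of_nonneg_left hd hG.M_nonneg
  obtain ⟨u, hu, hle⟩ := (mem_cthickening_iff_exists_norm_le hc hε.le).1 hmem
  refine ⟨u, hu, ?_⟩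
  have hpos : 0 < b - a := sub_pos.2 hlt
  have : W b - W a = (b - a) • ⨍ τ in Ioc a b, v τ := by
    rw [hsub a ha' b hb', ← uIoc_of_le hab, interval_average_eq, smul_inv_smul₀ hpos.ne']
  rw [this, ← smul_sub, norm_smul, Real.norm_of_nonneg hpos.le, mul_comm]
  exact mul_le_mul_of_nonneg_right hle hpos.le

theorem IsTame.isTraj_of_integral [CompleteSpace E] (hG : IsTame T M L δ G) (hs : 0 ≤ s)
    (hv : IntegrableOn v (Icc s T)) (hae : ∀ᵐ t : ℝ, t ∈ Icc s T → v t ∈ G t (W t))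
    (hW : ∀ t ∈ Icc s T, W t = W s + ∫ τ in s..t, v τ) : IsTraj G M s T W where
  lip := (norm_sub_le_of_integral hv (by
    filter_upwards [hae] with t ht hmem
    exact hG.norm_le t (Icc_subset_Icc_left hs hmem) _ _ (ht hmem)) hW).2
  slope ε hε := ⟨stepSize M L δ ε, hG.stepSize_pos hε, fun _ _ ha hab hb hba =>
    hG.slope_of_integral hs hv hae hW hε ha.le hab hb hba⟩

end Integral

/-- A Lipschitz curve in a finite-dimensional space is the integral of its derivative. -/
theorem integral_deriv_eq_sub_of_lipschitzWith [FiniteDimensional ℝ E] {K : ℝ≥0}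
    (hW : LipschitzWith K W) (a b : ℝ) :
    IntervalIntegrable (deriv W) volume a b ∧ ∫ t in a..b, deriv W t = W b - W a := by
  have : CompleteSpace E := FiniteDimensional.complete ℝ E
  have hint : IntervalIntegrable (deriv W) volume a b := by
    borelize E
    have hm : AEStronglyMeasurable (deriv W) (volume.restrict (uIoc a b)) :=
      (stronglyMeasurable_deriv W).aestronglyMeasurable
    refine (intervalIntegrable_const (c := (K : ℝ))).mono_fun hm ?_
    filter_upwards with t
    simpa using norm_deriv_le_of_lipschitz hW
  refine ⟨hint, ?_⟩
  -- Testing against functionals reduces the claim to the scalar fundamental theorem for absolutely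
  -- continuous functions.
  refine (SeparatingDual.eq_iff_forall_dual_eq (R := ℝ)).2 fun ℓ => ?_
  have hℓ := (ℓ.lipschitz.comp hW).lipschitzOnWith (s := uIcc a b)
  have hsub := hℓ.absolutelyContinuousOnInterval.integral_deriv_eq_sub
  simp only [Function.comp_apply] at hsub
  rw [map_sub, ← hsub, ← ℓ.intervalIntegral_comp_comm hint]
  refine intervalIntegral.integral_congr_ae ?_
  filter_upwards [hW.ae_differentiableAt_real] with t ht _
  exact (ℓ.hasFDerivAt.comp_hasDerivAt t ht.hasDerivAt).deriv.symm

/-- A curve satisfying the increment condition is an integral curve. -/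
theorem IsTraj.exists_integral [FiniteDimensional ℝ E] (hW : IsTraj G M s T W)
    (hsT : s ≤ T) (hM : 0 ≤ M) (hcl : ∀ t ∈ Icc s T, ∀ ξ, IsCompact (G t ξ)) :
    ∃ v : ℝ → E, IntegrableOn v (Icc s T) ∧ (∀ᵐ t : ℝ, t ∈ Icc s T → v t ∈ G t (W t)) ∧
      ∀ t ∈ Icc s T, W t = W s + ∫ τ in s..t, v τ := by
  -- Freezing the curve outside `[s, T]` makes it globally Lipschitz, hence differentiable almost
  -- everywhere.
  set Z : ℝ → E := fun t => W (projIcc s T hsT t) with hZ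
  have hZW : ∀ t ∈ Icc s T, Z t = W t := fun t ht => by simp [hZ, projIcc_of_mem hsT ht]
  have hlip : LipschitzWith M.toNNReal Z := by
    refine LipschitzWith.of_dist_le_mul fun a b => ?_
    rw [dist_comm, dist_eq_norm, Real.coe_toNNReal _ hM]
    refine (hW.lip _ (projIcc s T hsT a).2 _ (projIcc s T hsT b).2).trans ?_
    refine mul_le_mul_of_nonneg_left ?_ hM
    rw [← Real.dist_eq, ← Subtype.dist_eq]
    simpa [dist_comm] using (LipschitzWith.projIcc hsT).dist_le_mul b a
  refine ⟨deriv Z, ?_, ?_, ?_⟩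
  · rw [integrableOn_Icc_iff_integrableOn_Ioc, ← intervalIntegrable_iff_integrableOn_Ioc_of_le hsT]
    exact (integral_deriv_eq_sub_of_lipschitzWith hlip s T).1
  · have h1 : ∀ᵐ t : ℝ, t ≠ s := by simp [ae_iff]
    have h2 : ∀ᵐ t : ℝ, t ≠ T := by simp [ae_iff]
    filter_upwards [hlip.ae_differentiableAt_real, h1, h2] with t hd hs' hT' ht
    have hst : s < t := ht.1.lt_of_ne hs'.symm
    have htT : t < T := ht.2.lt_of_ne hT'
    have hc := hcl t ht (W t)
    have hslope := hasDerivAt_iff_tendsto_slope.1 hd.hasDerivAt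
    have hslope' : Tendsto (_root_.slope Z t) (𝓝[>] t) (𝓝 (deriv Z t)) :=
      hslope.mono_left (nhdsWithin_mono _ fun x hx => ne_of_gt hx)
    -- Right difference quotients lie eventually in each closed thickening of `G t (W t)`;
    -- intersecting over `ε` recovers this closed set.
    have hmem : ∀ ε > 0, deriv Z t ∈ Metric.cthickening ε (G t (W t)) := by
      intro ε hε
      obtain ⟨η, hη, hη'⟩ := hW.slope ε hε
      refine Metric.isClosed_cthickening.mem_of_tendsto hslope' ?_
      have hI : Ioo t (min T (t + η)) ∈ 𝓝[>] t := Ioo_mem_nhdsGT (lt_min htT (by linarith))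
      filter_upwards [hI] with b hb
      have hbT : b ≤ T := hb.2.le.trans (min_le_left _ _)
      have hbη : b - t ≤ η := by linarith [hb.2.le.trans (min_le_right T (t + η))]
      obtain ⟨v, hv, hle⟩ := hη' t b hst hb.1.le hbT hbη
      rw [mem_cthickening_iff_exists_norm_le hc hε.le]
      refine ⟨v, hv, ?_⟩
      have hpos : 0 < b - t := sub_pos.2 hb.1
      rw [slope_def_module, hZW t ht, hZW b ⟨hst.le.trans hb.1.le, hbT⟩]
      have : (b - t)⁻¹ • (W b - W t) - v = (b - t)⁻¹ • (W b - W t - (b - t) • v) := by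
        rw [smul_sub _ _ ((b - t) • v), inv_smul_smul₀ hpos.ne']
      rw [this, norm_smul, norm_inv, Real.norm_of_nonneg hpos.le, inv_mul_le_iff₀ hpos, mul_comm]
      exact hle
    have := mem_iInter₂.2 hmem
    rw [← Metric.closure_eq_iInter_cthickening] at this
    rwa [hc.isClosed.closure_eq] at this
  · intro t ht
    rw [(integral_deriv_eq_sub_of_lipschitzWith hlip s t).2, hZW t ht, hZW s ⟨le_rfl, hsT⟩]
    abel

/-- Trajectories of tame inclusions have a common step size, and the increment condition extends
to the initial time. -/
theorem IsTame.slope_of_isTraj [FiniteDimensional ℝ E] (hG : IsTame T M L δ G) (hs : 0 ≤ s)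
    (hW : IsTraj G M s T W) {ε : ℝ} (hε : 0 < ε) {a b : ℝ}
    (ha : s ≤ a) (hab : a ≤ b) (hb : b ≤ T) (hba : b - a ≤ stepSize M L δ ε) :
    ∃ u ∈ G a (W a), ‖W b - W a - (b - a) • u‖ ≤ ε * (b - a) := by
  have : CompleteSpace E := FiniteDimensional.complete ℝ E
  -- Differentiating and averaging again trades the curve-dependent `η` for the common step and
  -- includes `a = s`.
  obtain ⟨v, hv, hae, hint⟩ := hW.exists_integral (ha.trans (hab.trans hb)) hG.M_nonneg
    fun t ht => hG.compact t (Icc_subset_Icc_left hs ht)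
  exact hG.slope_of_integral hs hv hae hint hε ha hab hb hba

/-- Pointwise limits of curves which satisfy the increment condition asymptotically. -/
theorem isTraj_of_tendsto {ι : Type*} {l : Filter ι} [l.NeBot] {Gi : ι → ℝ → E → Set E}
    {Wi : ι → ℝ → E} (hlip : ∀ a ∈ Icc s T, ∀ b ∈ Icc s T, ‖W b - W a‖ ≤ M * |b - a|)
    (hW : ∀ t ∈ Icc s T, Tendsto (fun i => Wi i t) l (𝓝 (W t)))
    (hslope : ∀ ε > 0, ∃ η > 0, ∀ a b, s < a → a < b → b ≤ T → b - a ≤ η →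
      ∀ᶠ i in l, ∃ v ∈ Gi i a (Wi i a), ‖Wi i b - Wi i a - (b - a) • v‖ ≤ ε * (b - a))
    (hGi : ∀ a ∈ Icc s T, ∀ ε > 0, ∀ᶠ i in l, ∀ v ∈ Gi i a (Wi i a),
      ∃ v' ∈ G a (W a), ‖v - v'‖ ≤ ε)
    (hne : ∀ a ∈ Icc s T, (G a (W a)).Nonempty) : IsTraj G M s T W where
  lip := hlip
  slope ε hε := by
    obtain ⟨η, hη, h⟩ := hslope (ε / 3) (by positivity)
    refine ⟨η, hη, fun a b ha hab hb hba => ?_⟩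
    have ha' : a ∈ Icc s T := ⟨ha.le, hab.trans hb⟩
    have hb' : b ∈ Icc s T := ⟨ha.le.trans hab, hb⟩
    rcases hab.eq_or_lt with rfl | hlt
    · obtain ⟨v, hv⟩ := hne a ha'
      exact ⟨v, hv, by simp⟩
    have hpos : 0 < b - a := sub_pos.2 hlt
    have hconv : ∀ᶠ i in l, ‖(Wi i b - Wi i a) - (W b - W a)‖ < ε / 3 * (b - a) := by
      have := ((hW b hb').sub (hW a ha')).sub_const (W b - W a)
      rw [sub_self] at this
      exact (tendsto_zero_iff_norm_tendsto_zero.1 this).eventually_lt_const (by positivity)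
    -- Three errors of `ε / 3`: convergence of the increments, the approximate slope, and replacing
    -- `Gi` by `G`.
    obtain ⟨i, hi1, ⟨v, hv, hi2⟩, hi3⟩ :=
      (hconv.and ((h a b ha hlt hb hba).and (hGi a ha' (ε / 3) (by positivity)))).exists
    obtain ⟨v', hv', hi4⟩ := hi3 v hv
    refine ⟨v', hv', ?_⟩
    have : W b - W a - (b - a) • v' = -((Wi i b - Wi i a) - (W b - W a)) +
        (Wi i b - Wi i a - (b - a) • v) + (b - a) • (v - v') := by
      rw [smul_sub]; abel
    rw [this]
    refine (norm_add₃_le).trans ?_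
    rw [norm_neg, norm_smul, Real.norm_of_nonneg hpos.le]
    nlinarith

end Inclusion

/-! ### Filippov's theorem by an Euler scheme. -/

section Euler

variable {E : Type*} [NormedAddCommGroup E] [NormedSpace ℝ E]
variable {T M L s h : ℝ} {δ : ℝ → ℝ} {G : ℝ → E → Set E} {W : ℝ → E} {X : ℕ → E}

/-- Sums of increments which are close to multiples of elements of a convex set. -/
theorem exists_mem_norm_sub_smul_le {A : Set E} (hA : Convex ℝ A) (hne : A.Nonempty) {ε : ℝ}
    (X : ℕ → E) (k : ℕ)
    (hX : ∀ i < k, ∃ v ∈ A, ‖X (i + 1) - X i - h • v‖ ≤ ε * h) :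
    ∃ u ∈ A, ‖X k - X 0 - (k * h) • u‖ ≤ ε * (k * h) := by
  induction k with
  | zero =>
    obtain ⟨u, hu⟩ := hne
    exact ⟨u, hu, by simp⟩
  | succ k ih =>
    obtain ⟨u, hu, h1⟩ := ih fun i hi => hX i (hi.trans (Nat.lt_succ_self k))
    obtain ⟨v, hv, h2⟩ := hX k (Nat.lt_succ_self k)
    have hk : (0 : ℝ) < k + 1 := by positivity
    refine ⟨(k / (k + 1) : ℝ) • u + (1 / (k + 1) : ℝ) • v,
      hA hu hv (by positivity) (by positivity) (by field_simp), ?_⟩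
    have e1 : ((k + 1 : ℕ) * h : ℝ) • ((k / (k + 1) : ℝ) • u + (1 / (k + 1) : ℝ) • v) =
        (k * h : ℝ) • u + h • v := by
      rw [smul_add, smul_smul, smul_smul]
      congr 2 <;> · push_cast; field_simp
    have e2 : X (k + 1) - X 0 - ((k * h : ℝ) • u + h • v) =
        (X k - X 0 - (k * h : ℝ) • u) + (X (k + 1) - X k - h • v) := by abel
    rw [e1, e2]
    refine (norm_add_le _ _).trans ?_
    push_cast
    linarith

/-- The nodes of an Euler scheme with step `h` which follows the curve `W` as closely as possible. -/
def IsEuler (G : ℝ → E → Set E) (W : ℝ → E) (s T h : ℝ) (X : ℕ → E) : Prop :=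
  ∀ j : ℕ, s + (j + 1) * h ≤ T → ∃ v ∈ G (s + j * h) (X j), X (j + 1) = X j + h • v ∧
    ∀ v' ∈ G (s + j * h) (X j), ‖W (s + (j + 1) * h) - W (s + j * h) - h • v‖ ≤
      ‖W (s + (j + 1) * h) - W (s + j * h) - h • v'‖

theorem mem_Icc_node (hs : 0 ≤ s) (hh : 0 ≤ h) {j : ℕ} (hj : s + j * h ≤ T) :
    s + j * h ∈ Icc 0 T := ⟨by positivity, hj⟩

theorem node_le_succ (hh : 0 ≤ h) (j : ℕ) : s + j * h ≤ s + (j + 1) * h := by nlinarith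

/-- Compactness of the values provides the best velocity at each node. Steps leaving `[s, T]` carry
no condition, so the node is simply repeated there. -/
theorem IsTame.exists_isEuler (hG : IsTame T M L δ G) (hs : 0 ≤ s) (hh : 0 ≤ h) (W : ℝ → E)
    (ξ : E) : ∃ X : ℕ → E, X 0 = ξ ∧ IsEuler G W s T h X := by
  have hstep : ∀ (j : ℕ) (x : E), ∃ x' : E, s + (j + 1) * h ≤ T →
      ∃ v ∈ G (s + j * h) x, x' = x + h • v ∧
        ∀ v' ∈ G (s + j * h) x, ‖W (s + (j + 1) * h) - W (s + j * h) - h • v‖ ≤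
          ‖W (s + (j + 1) * h) - W (s + j * h) - h • v'‖ := by
    intro j x
    by_cases hj : s + (j + 1) * h ≤ T
    · have hm := mem_Icc_node hs hh ((node_le_succ hh j).trans hj)
      obtain ⟨v, hv, hmin⟩ := (hG.compact _ hm x).exists_isMinOn (hG.nonempty _ hm x)
        (f := fun v => ‖W (s + (j + 1) * h) - W (s + j * h) - h • v‖)
        (by fun_prop : Continuous _).continuousOn
      exact ⟨x + h • v, fun _ => ⟨v, hv, rfl, fun v' hv' => hmin hv'⟩⟩
    · exact ⟨x, fun hj' => absurd hj' hj⟩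
  choose F hF using hstep
  exact ⟨fun j => Nat.rec ξ F j, rfl, fun j hj => hF j _ hj⟩

theorem IsEuler.norm_sub_le (hX : IsEuler G W s T h X) (hG : IsTame T M L δ G) (hs : 0 ≤ s)
    (hh : 0 ≤ h) (j k : ℕ) (hj : s + (j + k : ℕ) * h ≤ T) :
    ‖X (j + k) - X j‖ ≤ M * (k * h) := by
  induction k with
  | zero => simp
  | succ k ih =>
    push_cast at hj
    have hj' : s + ((j + k : ℕ) + 1) * h ≤ T := by push_cast; linarith
    have hjk := (node_le_succ (s := s) hh (j + k)).trans hj'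
    obtain ⟨v, hv, hXv, -⟩ := hX (j + k) hj'
    have hvM := hG.norm_le _ (mem_Icc_node hs hh hjk) _ _ hv
    have e : X (j + (k + 1)) - X j = (X (j + k) - X j) + h • v := by
      rw [← add_assoc, hXv]; abel
    rw [e]
    refine (norm_add_le _ _).trans ?_
    rw [norm_smul, Real.norm_of_nonneg hh]
    have := ih hjk
    push_cast
    nlinarith

/-- Discrete Gronwall estimate for the distance of the Euler scheme to the curve it follows. -/
theorem IsEuler.norm_sub_curve_le (hX : IsEuler G W s T h X) (hG : IsTame T M L δ G) (hs : 0 ≤ s)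
    (hh : 0 ≤ h) {R : ℝ → ℝ} (hR : Monotone R) {ε : ℝ} (hε : 0 < ε)
    (hW : ∀ a b, s ≤ a → a ≤ b → b ≤ T → b - a ≤ h →
      ∃ v ∈ G a (W a), ‖W b - W a - (b - a) • v‖ ≤ ε * (b - a) + (R b - R a))
    (j : ℕ) (hj : s + j * h ≤ T) :
    ‖X j - W (s + j * h)‖ ≤ Real.exp (L * (j * h)) *
      (‖X 0 - W s‖ + (R (s + j * h) - R s) + 2 * ε * (j * h)) := by
  induction j with
  | zero => simp
  | succ j ih =>
    have hj1 : s + (j + 1) * h ≤ T := by push_cast at hj; exact hj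
    have hj0 := (node_le_succ hh j).trans hj1
    have hm := mem_Icc_node hs hh hj0
    have hIH := ih hj0
    obtain ⟨v, hv, hXv, hmin⟩ := hX j hj1
    obtain ⟨u, hu, hle⟩ := hW (s + j * h) (s + (j + 1) * h) (by nlinarith [hm.1, j.cast_nonneg (α := ℝ)])
      (node_le_succ hh j) hj1 (by linarith)
    -- `u'` is a competitor for `v`: an admissible velocity at `X j` within `ε + L * ‖X j - B‖` of
    -- the curve's velocity `u`. One `ε` arises here and one in `hW`, whence `2 * ε` in the bound.
    obtain ⟨u', hu', hle'⟩ := hG.near ε hε _ hm _ hm (by simpa using (hG.δ_pos ε hε).le) _ (X j) u hu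
    have hbd := hmin u' hu'
    have eh : s + (j + 1) * h - (s + j * h) = h := by ring
    rw [eh] at hle
    push_cast
    set A := W (s + (j + 1) * h)
    set B := W (s + j * h)
    set D := ‖X j - B‖ with hD
    have e1 : A - B - h • u' = (A - B - h • u) + h • (u - u') := by rw [smul_sub]; abel
    have h1 : ‖A - B - h • u'‖ ≤ ε * h + (R (s + (j + 1) * h) - R (s + j * h)) +
        h * (ε + L * D) := by
      rw [e1]
      refine (norm_add_le _ _).trans (add_le_add hle ?_)
      rw [norm_smul, Real.norm_of_nonneg hh]
      rw [norm_sub_rev B] at hle'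
      exact mul_le_mul_of_nonneg_left hle' hh
    have h2 : ‖X (j + 1) - A‖ ≤ D + ‖A - B - h • v‖ := by
      have : X (j + 1) - A = (X j - B) - (A - B - h • v) := by rw [hXv]; abel
      rw [this]
      exact _root_.norm_sub_le _ _
    have hLh : 0 ≤ L * h := mul_nonneg hG.L_nonneg hh
    have hexp : (1 + L * h) * Real.exp (L * (j * h)) ≤ Real.exp (L * ((j + 1) * h)) := by
      have : L * ((j + 1) * h) = L * h + L * (j * h) := by ring
      rw [this, Real.exp_add]
      refine mul_le_mul_of_nonneg_right ?_ (Real.exp_pos _).le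
      linarith [Real.add_one_le_exp (L * h)]
    have hone : 1 ≤ Real.exp (L * ((j + 1) * h)) := Real.one_le_exp (by
      have := hG.L_nonneg; positivity)
    have hRj : 0 ≤ R (s + j * h) - R s := sub_nonneg.2 (hR (by nlinarith [j.cast_nonneg (α := ℝ)]))
    have hRj' : 0 ≤ R (s + (j + 1) * h) - R (s + j * h) := sub_nonneg.2 (hR (node_le_succ hh j))
    set P := ‖X 0 - W s‖ + (R (s + j * h) - R s) + 2 * ε * (j * h) with hP
    have hP0 : 0 ≤ P := by positivity
    have h3 : (1 + L * h) * D ≤ Real.exp (L * ((j + 1) * h)) * P :=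
      calc (1 + L * h) * D ≤ (1 + L * h) * (Real.exp (L * (j * h)) * P) :=
            mul_le_mul_of_nonneg_left hIH (by linarith)
        _ = ((1 + L * h) * Real.exp (L * (j * h))) * P := by ring
        _ ≤ _ := mul_le_mul_of_nonneg_right hexp hP0
    have h4 : 2 * ε * h + (R (s + (j + 1) * h) - R (s + j * h)) ≤
        Real.exp (L * ((j + 1) * h)) * (2 * ε * h + (R (s + (j + 1) * h) - R (s + j * h))) :=
      le_mul_of_one_le_left (by positivity) hone
    calc ‖X (j + 1) - A‖ ≤ (1 + L * h) * D + (2 * ε * h + (R (s + (j + 1) * h) - R (s + j * h))) := by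
          linarith
      _ ≤ Real.exp (L * ((j + 1) * h)) * P +
          Real.exp (L * ((j + 1) * h)) * (2 * ε * h + (R (s + (j + 1) * h) - R (s + j * h))) :=
          add_le_add h3 h4
      _ = _ := by rw [hP]; ring

/-- Filippov's theorem: near a curve `W` which solves the inclusion up to an error with
primitive `R`, there is a solution with any prescribed initial value. -/
theorem IsTame.exists_isTraj_near [FiniteDimensional ℝ E] (hG : IsTame T M L δ G) (hs : 0 ≤ s)
    (hsT : s ≤ T) {R : ℝ → ℝ} (hR : Monotone R)
    (hlip : ∀ a ∈ Icc s T, ∀ b ∈ Icc s T, ‖W b - W a‖ ≤ M * |b - a|)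
    (hW : ∀ ε > 0, ∃ η > 0, ∀ a b, s ≤ a → a ≤ b → b ≤ T → b - a ≤ η →
      ∃ v ∈ G a (W a), ‖W b - W a - (b - a) • v‖ ≤ ε * (b - a) + (R b - R a)) (ξ : E) :
    ∃ X : ℝ → E, IsTraj G M s T X ∧ X s = ξ ∧
      ∀ t ∈ Icc s T, ‖X t - W t‖ ≤ Real.exp (L * (t - s)) * (‖ξ - W s‖ + (R t - R s)) := by
  have : ProperSpace E := FiniteDimensional.proper ℝ E
  have hM := hG.M_nonneg
  let h : ℕ → ℝ := fun N => 1 / ((N : ℝ) + 1)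
  have hh : ∀ N, 0 < h N := fun N => Nat.one_div_pos_of_nat
  have hlim : Tendsto h atTop (𝓝 0) := tendsto_one_div_add_atTop_nhds_zero_nat
  choose X hX0 hX using fun N => hG.exists_isEuler hs (hh N).le W ξ
  -- Index of the last node not after `t`. The interpolation `Y` below is piecewise constant, hence
  -- `M`-Lipschitz only up to one step `h N`.
  let J : ℕ → ℝ → ℕ := fun N t => ⌊(t - s) / h N⌋₊
  have hJ1 : ∀ N, ∀ t, s ≤ t → s + J N t * h N ≤ t := fun N t ht => by
    have := Nat.floor_le (div_nonneg (sub_nonneg.2 ht) (hh N).le)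
    rw [le_div_iff₀ (hh N)] at this
    linarith
  have hJ2 : ∀ N t, t < s + (J N t + 1) * h N := fun N t => by
    have := Nat.lt_floor_add_one ((t - s) / h N)
    rw [div_lt_iff₀ (hh N)] at this
    linarith
  let Y : ℕ → ℝ → E := fun N t => X N (J N t)
  have hYs : ∀ N, Y N s = ξ := fun N => by simp [Y, J, hX0]
  have hYlip : ∀ N, ∀ a b, s ≤ a → a ≤ b → b ≤ T → ‖Y N b - Y N a‖ ≤ M * (b - a + h N) := by
    intro N a b ha hab hb
    have hJab : J N a ≤ J N b := Nat.floor_le_floor (by have := hh N; gcongr)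
    obtain ⟨k, hk⟩ := Nat.exists_eq_add_of_le hJab
    have hJb := hJ1 N b (ha.trans hab)
    have hJa := hJ2 N a
    have := (hX N).norm_sub_le hG hs (hh N).le (J N a) k (by rw [← hk]; exact hJb.trans hb)
    rw [← hk] at this
    refine this.trans (mul_le_mul_of_nonneg_left ?_ hM)
    rw [hk] at hJb
    push_cast at hJb
    linarith
  -- An ultrafilter makes the bounded approximations converge at all times simultaneously, without
  -- extracting subsequences.
  let 𝒰 : Ultrafilter ℕ := hyperfilter ℕ
  have h𝒰 : (𝒰 : Filter ℕ) ≤ atTop := Nat.hyperfilter_le_atTop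
  have hlim' : Tendsto h 𝒰 (𝓝 0) := hlim.mono_left h𝒰
  have hex : ∀ t, ∃ x : E, t ∈ Icc s T → Tendsto (fun N => Y N t) 𝒰 (𝓝 x) := by
    intro t
    by_cases ht : t ∈ Icc s T
    · have hmem : ∀ N, Y N t ∈ Metric.closedBall ξ (M * (t - s + 1)) := fun N => by
        rw [mem_closedBall_iff_norm, ← hYs N]
        refine (hYlip N s t le_rfl ht.1 ht.2).trans (mul_le_mul_of_nonneg_left ?_ hM)
        have : h N ≤ 1 := by
          simp only [h]
          rw [div_le_one (by positivity)]
          linarith [N.cast_nonneg (α := ℝ)]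
        linarith
      obtain ⟨x, -, hx⟩ := (isCompact_closedBall ξ (M * (t - s + 1))).ultrafilter_le_nhds'
        (𝒰.map fun N => Y N t)
        (Filter.mem_map.2 (Eventually.of_forall hmem))
      exact ⟨x, fun _ => hx⟩
    · exact ⟨0, fun ht' => absurd ht' ht⟩
  choose Z hZ using hex
  have hZlip : ∀ a ∈ Icc s T, ∀ b ∈ Icc s T, a ≤ b → ‖Z b - Z a‖ ≤ M * (b - a) := by
    intro a ha b hb hab
    have h1 := ((hZ b hb).sub (hZ a ha)).norm
    have h2 : Tendsto (fun N => M * (b - a + h N)) 𝒰 (𝓝 (M * (b - a + 0))) :=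
      (hlim'.const_add _).const_mul _
    rw [add_zero] at h2
    exact le_of_tendsto_of_tendsto' h1 h2 fun N => hYlip N a b ha.1 hab hb.2
  have hsub : Icc s T ⊆ Icc 0 T := Icc_subset_Icc_left hs
  refine ⟨Z, isTraj_of_tendsto (l := (𝒰 : Filter ℕ)) (Gi := fun _ => G) (Wi := Y) ?_ hZ ?_ ?_ ?_,
    ?_, ?_⟩
  · intro a ha b hb
    rcases le_total a b with hab | hab
    · rw [abs_of_nonneg (sub_nonneg.2 hab)]
      exact hZlip a ha b hb hab
    · rw [norm_sub_rev, abs_sub_comm, abs_of_nonneg (sub_nonneg.2 hab)]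
      exact hZlip b hb a ha hab
  · intro ε hε
    have hε2 := half_pos hε
    have hη := hG.stepSize_pos hε2
    -- Nodes attached to `[a, b]` spread over a time of at most `b - a + h N`; the halving leaves
    -- room for `h N`.
    refine ⟨stepSize M L δ (ε / 2) / 2, half_pos hη, fun a b ha hab hb hba => ?_⟩
    have ha' : a ∈ Icc s T := ⟨ha.le, hab.le.trans hb⟩
    have hpos : 0 < b - a := sub_pos.2 hab
    have e1 := hlim'.eventually_le_const (half_pos hη)
    have e2 : ∀ᶠ N in (𝒰 : Filter ℕ), h N * (ε / 2 + M) ≤ ε / 2 * (b - a) := by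
      have := hlim'.mul_const (ε / 2 + M)
      rw [zero_mul] at this
      exact this.eventually_le_const (by positivity)
    filter_upwards [e1, e2] with N hN1 hN2
    have hJab : J N a ≤ J N b := Nat.floor_le_floor (by have := hh N; gcongr)
    obtain ⟨k, hk⟩ := Nat.exists_eq_add_of_le hJab
    have hJb := hJ1 N b (ha.le.trans hab.le)
    have hJb' := hJ2 N b
    have hJa := hJ2 N a
    have hJa' := hJ1 N a ha.le
    rw [hk] at hJb hJb'
    push_cast at hJb hJb'
    have hA := hG.convex a (hsub ha') (Y N a)
    have hAne := hG.nonempty a (hsub ha') (Y N a)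
    obtain ⟨u, hu, hle⟩ := exists_mem_norm_sub_smul_le hA hAne (ε := ε / 2)
      (fun i => X N (J N a + i)) k (by
        intro i hi
        have hik : ((i : ℝ) + 1) ≤ k := by exact_mod_cast hi
        have hik' := mul_le_mul_of_nonneg_right hik (hh N).le
        have hi0 : 0 ≤ (i : ℝ) * h N := mul_nonneg i.cast_nonneg (hh N).le
        have hT1 : s + ((J N a + i : ℕ) + 1) * h N ≤ T := by push_cast; linarith
        have hT0 := (node_le_succ (s := s) (hh N).le (J N a + i)).trans hT1
        obtain ⟨v, hv, hXv, -⟩ := hX N (J N a + i) hT1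
        have hn := (hX N).norm_sub_le hG hs (hh N).le (J N a) i hT0
        obtain ⟨v', hv', hle'⟩ := hG.near_of_le_stepSize (h := b - a + h N) hε2 (by linarith)
          (mem_Icc_node hs (hh N).le hT0) (hsub ha') (by
            push_cast
            rw [abs_le]
            constructor <;> linarith) (ξ' := Y N a)
          (hn.trans (mul_le_mul_of_nonneg_left (by linarith) hM)) hv
        refine ⟨v', hv', ?_⟩
        have : X N (J N a + (i + 1)) - X N (J N a + i) - h N • v' = h N • (v - v') := by
          rw [← add_assoc, hXv, smul_sub]; abel
        rw [this, norm_smul, Real.norm_of_nonneg (hh N).le, mul_comm]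
        exact mul_le_mul_of_nonneg_right hle' (hh N).le)
    refine ⟨u, hu, ?_⟩
    have hYb : Y N b = X N (J N a + k) := by rw [← hk]
    have e3 : Y N b - Y N a - (b - a) • u =
        (X N (J N a + k) - X N (J N a + 0) - (k * h N) • u) + (k * h N - (b - a)) • u := by
      rw [hYb, sub_smul (k * h N)]
      simp only [Y, add_zero]
      abel
    rw [e3]
    refine (norm_add_le _ _).trans ?_
    rw [norm_smul, Real.norm_eq_abs]
    have hku : |k * h N - (b - a)| ≤ h N := by
      rw [abs_le]; constructor <;> linarith
    have huM := hG.norm_le _ (hsub ha') _ _ hu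
    have h5 : |k * h N - (b - a)| * ‖u‖ ≤ h N * M :=
      mul_le_mul hku huM (norm_nonneg _) (hh N).le
    have h6 : ε / 2 * (k * h N) ≤ ε / 2 * (b - a + h N) :=
      mul_le_mul_of_nonneg_left (by linarith) hε2.le
    linarith
  · intro a ha ε hε
    have h1 : Tendsto (fun N => L * ‖Y N a - Z a‖) 𝒰 (𝓝 (L * 0)) := by
      refine Tendsto.const_mul _ ?_
      have := (hZ a ha).sub_const (Z a)
      rw [sub_self] at this
      exact tendsto_zero_iff_norm_tendsto_zero.1 this
    rw [mul_zero] at h1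
    filter_upwards [h1.eventually_le_const (half_pos hε)] with N hN v hv
    obtain ⟨v', hv', hle⟩ := hG.near (ε / 2) (half_pos hε) a (hsub ha) a (hsub ha)
      (by simpa using (hG.δ_pos _ (half_pos hε)).le) _ (Z a) v hv
    exact ⟨v', hv', hle.trans (by linarith)⟩
  · exact fun a ha => hG.nonempty a (hsub ha) _
  · have := hZ s ⟨le_rfl, hsT⟩
    simp only [hYs] at this
    exact tendsto_nhds_unique this tendsto_const_nhds
  · intro t ht
    -- The discrete Gronwall estimate survives in the limit with the slack `2 * ε * (t - s)`, which
    -- is removed at the end by `ε → 0`.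
    have hbound : ∀ ε > 0, ‖Z t - W t‖ ≤
        Real.exp (L * (t - s)) * (‖ξ - W s‖ + (R t - R s) + 2 * ε * (t - s)) := by
      intro ε hε
      obtain ⟨η, hη, hη'⟩ := hW ε hε
      have h1 := ((hZ t ht).sub_const (W t)).norm
      have h2 : Tendsto (fun N => Real.exp (L * (t - s)) *
          (‖ξ - W s‖ + (R t - R s) + 2 * ε * (t - s)) + M * h N) 𝒰 (𝓝 (Real.exp (L * (t - s)) *
          (‖ξ - W s‖ + (R t - R s) + 2 * ε * (t - s)) + M * 0)) :=
        (hlim'.const_mul _).const_add _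
      rw [mul_zero, add_zero] at h2
      refine le_of_tendsto_of_tendsto h1 h2 ?_
      filter_upwards [hlim'.eventually_le_const hη] with N hN
      have hJt := hJ1 N t ht.1
      have hJt' := hJ2 N t
      have h3 := (hX N).norm_sub_curve_le hG hs (hh N).le hR hε
        (fun a b ha hab hb hba => hη' a b ha hab hb (hba.trans hN)) (J N t) (hJt.trans ht.2)
      have hJ0 : 0 ≤ (J N t : ℝ) * h N := mul_nonneg (Nat.cast_nonneg _) (hh N).le
      have h4 := hlip t ht (s + J N t * h N) ⟨by linarith, hJt.trans ht.2⟩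
      have h5 : M * |s + J N t * h N - t| ≤ M * h N := by
        refine mul_le_mul_of_nonneg_left ?_ hM
        rw [abs_le]; constructor <;> linarith
      have e : Y N t - W t = (X N (J N t) - W (s + J N t * h N)) + (W (s + J N t * h N) - W t) := by
        simp only [Y]; abel
      rw [e]
      refine (norm_add_le _ _).trans (add_le_add (h3.trans ?_) (h4.trans h5))
      rw [hX0]
      have hRt := hR hJt
      have hRs : R s ≤ R (s + J N t * h N) := hR (by linarith)
      have := hG.L_nonneg
      gcongr
      · linarith
      · linarith
    have h1 : Tendsto (fun ε : ℝ => Real.exp (L * (t - s)) *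
        (‖ξ - W s‖ + (R t - R s) + 2 * ε * (t - s))) (𝓝[>] 0) (𝓝 (Real.exp (L * (t - s)) *
        (‖ξ - W s‖ + (R t - R s) + 2 * 0 * (t - s)))) := by
      refine tendsto_nhdsWithin_of_tendsto_nhds ?_
      exact (by fun_prop : Continuous fun ε : ℝ => Real.exp (L * (t - s)) *
        (‖ξ - W s‖ + (R t - R s) + 2 * ε * (t - s))).tendsto 0
    simp only [mul_zero, zero_mul, add_zero] at h1
    exact ge_of_tendsto h1 (by filter_upwards [self_mem_nhdsWithin] with ε hε using hbound ε hε)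

end Euler

/-! ### Representatives of points of the torus. -/

section TorusLift

variable {d : ℕ}

theorem toTorus_add (x y : Fin d → ℝ) : toTorus (x + y) = toTorus x + toTorus y := rfl

theorem norm_toTorus_le (x : Fin d → ℝ) : ‖toTorus x‖ ≤ ‖x‖ := by
  refine (pi_norm_le_iff_of_nonneg (norm_nonneg x)).2 fun i => ?_
  refine le_trans ?_ (norm_le_pi_norm x i)
  simp only [toTorus]
  rw [UnitAddCircle.norm_eq]
  simpa using round_le (x i) 0

theorem norm_toTorus_sub_le (x y : Fin d → ℝ) : ‖toTorus x - toTorus y‖ ≤ ‖x - y‖ :=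
  norm_toTorus_le (x - y)

theorem continuous_toTorus : Continuous (toTorus : (Fin d → ℝ) → Torus d) :=
  continuous_pi fun i => (AddCircle.continuous_mk' 1).comp (continuous_apply i)

/-- Subtracting the nearest integer from each coordinate yields a representative that is no longer
than its class. -/
theorem exists_toTorus_eq (y : Torus d) : ∃ x, toTorus x = y ∧ ‖x‖ ≤ ‖y‖ := by
  have h : ∀ i, ∃ x : ℝ, (x : UnitAddCircle) = y i ∧ |x| = ‖y i‖ := by
    intro i
    obtain ⟨x, hx⟩ := QuotientAddGroup.mk_surjective (y i)
    refine ⟨x - round x, ?_, ?_⟩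
    · rw [← hx]
      refine (QuotientAddGroup.eq).2 ?_
      rw [AddSubgroup.mem_zmultiples_iff]
      exact ⟨round x, by simp⟩
    · rw [← hx]
      exact (UnitAddCircle.norm_eq (x := x)).symm
  choose x hx hx' using h
  refine ⟨x, funext hx, (pi_norm_le_iff_of_nonneg (norm_nonneg y)).2 fun i => ?_⟩
  rw [Real.norm_eq_abs, hx']
  exact norm_le_pi_norm y i

theorem norm_torus_le (y : Torus d) : ‖y‖ ≤ 1 / 2 := by
  refine (pi_norm_le_iff_of_nonneg (by norm_num)).2 fun i => ?_
  simpa using AddCircle.norm_le_half_period 1 (x := y i) one_ne_zero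

end TorusLift

/-! ### Crude bounds for the Kantorovich–Rubinstein distance. -/

namespace P1

variable {X : Type*} [MetricSpace X] [MeasurableSpace X]

theorem integral_sub_integral_le (m₁ m₂ : P1 X) {φ : X → ℝ} {c C : ℝ} (h : ∀ x, |φ x - c| ≤ C)
    (h₁ : Integrable φ m₁.measure) (h₂ : Integrable φ m₂.measure) :
    (∫ x, φ x ∂m₁.measure) - ∫ x, φ x ∂m₂.measure ≤ 2 * C := by
  have e1 : (∫ x, φ x ∂m₁.measure) ≤ ∫ _, (c + C) ∂m₁.measure :=
    integral_mono h₁ (integrable_const _) fun x => by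
      show φ x ≤ c + C
      linarith [(abs_le.1 (h x)).2]
  have e2 : (∫ _, (c - C) ∂m₂.measure) ≤ ∫ x, φ x ∂m₂.measure :=
    integral_mono (integrable_const _) h₂ fun x => by
      show c - C ≤ φ x
      linarith [(abs_le.1 (h x)).1]
  simp at e1 e2
  linarith

/-- A `1`-Lipschitz function on the torus stays within `1 / 2` of its value at `0`. With the
Lipschitz hypothesis this bounds `f` and `g` uniformly in the distribution. -/
theorem W1_torus_le {d : ℕ} (m₁ m₂ : P1 (Torus d)) : W1 m₁ m₂ ≤ 1 := by
  refine W1_le fun φ hφ => ?_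
  have := integral_sub_integral_le m₁ m₂ (φ := φ) (c := φ 0) (C := 1 / 2) (fun x => by
    have := hφ.dist_le_mul x 0
    rw [Real.dist_eq, dist_zero_right] at this
    exact this.trans (by simpa using norm_torus_le x)) (m₁.integrable_lip hφ) (m₂.integrable_lip hφ)
  linarith

/-- On a compact space every Borel probability has finite first moment. -/
def ofProb [CompactSpace X] [BorelSpace X] (μ : ProbabilityMeasure X) : P1 X where
  prob := μ
  moment := by
    obtain ⟨x₀⟩ := μ.nonempty
    exact ⟨x₀, (by fun_prop : Continuous fun x : X => dist x x₀).integrable_of_hasCompactSupport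
      (HasCompactSupport.of_compactSpace _)⟩

end P1

/-! ### Regularity of the vectogram, lifting to the cover, and comparison of trajectories. -/

section Vectogram

/-- The extended phase space `ℝᵈ × ℝ`, which covers `𝕋ᵈ × ℝ`. -/
abbrev Ext (d : ℕ) : Type := (Fin d → ℝ) × ℝ

variable {d : ℕ} {U : Type*} {T : ℝ}
  {f : ℝ → Torus d → P1 (Torus d) → U → (Fin d → ℝ)}
  {g : ℝ → Torus d → P1 (Torus d) → U → ℝ}
  {σ : Torus d → P1 (Torus d) → ℝ}

/-- The points within `ε` of the second hull form a convex set that contains the generators of the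
first. -/
theorem convexHull_range_near {E : Type*} [NormedAddCommGroup E] [NormedSpace ℝ E] {a b : U → E}
    {ε : ℝ} (h : ∀ u, ‖a u - b u‖ ≤ ε) : ∀ v ∈ convexHull ℝ (range a),
      ∃ v' ∈ convexHull ℝ (range b), ‖v - v'‖ ≤ ε := by
  have hconv : Convex ℝ {v | ∃ v' ∈ convexHull ℝ (range b), ‖v - v'‖ ≤ ε} := by
    rintro x ⟨x', hx', hx⟩ y ⟨y', hy', hy⟩ p q hp hq hpq
    refine ⟨p • x' + q • y', convex_convexHull ℝ _ hx' hy' hp hq hpq, ?_⟩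
    have e : p • x + q • y - (p • x' + q • y') = p • (x - x') + q • (y - y') := by
      rw [smul_sub, smul_sub]; abel
    rw [e]
    refine (norm_add_le _ _).trans ?_
    rw [norm_smul, norm_smul, Real.norm_of_nonneg hp, Real.norm_of_nonneg hq]
    calc p * ‖x - x'‖ + q * ‖y - y'‖ ≤ p * ε + q * ε := by gcongr
      _ = ε := by rw [← add_mul, hpq, one_mul]
  refine fun v hv => convexHull_min ?_ hconv hv
  rintro _ ⟨u, rfl⟩
  exact ⟨b u, subset_convexHull ℝ _ ⟨u, rfl⟩, h u⟩

/-- Uniform bounds for the vectogram: its values are compact, contained in the ball of radius `M`,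
uniformly continuous in time and `L`-Lipschitz in the state and in the distribution. -/
structure VectogramBounds (f : ℝ → Torus d → P1 (Torus d) → U → (Fin d → ℝ))
    (g : ℝ → Torus d → P1 (Torus d) → U → ℝ) (T M L : ℝ) (δ : ℝ → ℝ) : Prop where
  M_nonneg : 0 ≤ M
  L_nonneg : 0 ≤ L
  δ_pos : ∀ ε > 0, 0 < δ ε
  compact : ∀ t ∈ Icc 0 T, ∀ x m, IsCompact (vectogram f g t x m)
  nonempty : ∀ t ∈ Icc 0 T, ∀ x m, (vectogram f g t x m).Nonempty
  norm_le : ∀ t ∈ Icc 0 T, ∀ x m, ∀ v ∈ vectogram f g t x m, ‖v‖ ≤ M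
  near : ∀ ε > 0, ∀ t ∈ Icc 0 T, ∀ t' ∈ Icc 0 T, |t - t'| ≤ δ ε → ∀ x x' m m',
    ∀ v ∈ vectogram f g t x m, ∃ v' ∈ vectogram f g t' x' m',
      ‖v - v'‖ ≤ ε + L * (‖x - x'‖ + P1.W1 m m')

theorem Assumptions.exists_vectogramBounds [MetricSpace U] [CompactSpace U] [Nonempty U]
    (h : Assumptions T f g σ) : ∃ M L δ, VectogramBounds f g T M L δ := by
  obtain ⟨L₀, hL₀⟩ := h.lipschitz
  obtain ⟨α, hα0, hα, hαfg⟩ := h.modulus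
  set L := max L₀ 0
  have hL : ∀ t ∈ Icc 0 T, ∀ x' x'' m' m'' u,
      ‖(f t x' m' u, g t x' m' u) - (f t x'' m'' u, g t x'' m'' u)‖ ≤
        L * (‖x' - x''‖ + P1.W1 m' m'') := by
    intro t ht x' x'' m' m'' u
    have h1 := hL₀ t ht x' x'' m' m'' u
    have h2 : L₀ * (‖x' - x''‖ + P1.W1 m' m'') ≤ L * (‖x' - x''‖ + P1.W1 m' m'') :=
      mul_le_mul_of_nonneg_right (le_max_left _ _)
        (add_nonneg (norm_nonneg _) (dist_nonneg (x := m') (y := m'')))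
    exact max_le (h1.1.trans h2) (h1.2.trans h2)
  have hδ : ∀ ε : ℝ, ∃ η : ℝ, 0 < ε → 0 < η ∧ ∀ t ∈ Icc 0 T, ∀ t' ∈ Icc 0 T, |t - t'| ≤ η →
      ∀ x m u, ‖(f t x m u, g t x m u) - (f t' x m u, g t' x m u)‖ ≤ ε := by
    intro ε
    by_cases hε : 0 < ε
    · have h1 := hα.eventually_le_const hε
      rw [eventually_nhdsWithin_iff, Metric.eventually_nhds_iff] at h1
      obtain ⟨η, hη, h2⟩ := h1
      refine ⟨η / 2, fun _ => ⟨half_pos hη, fun t ht t' ht' htt x m u => ?_⟩⟩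
      -- The modulus tends to `0` only along nonzero increments, so equal times are separated.
      rcases eq_or_ne t t' with rfl | hne
      · simp [hε.le]
      · have h3 : α (t - t') ≤ ε := h2 (by
          rw [Real.dist_eq, sub_zero]; linarith) (sub_ne_zero.2 hne)
        have h4 := hαfg t ht t' ht' x m u
        exact max_le (h4.1.trans h3) (h4.2.trans h3)
    · exact ⟨0, fun h => absurd h hε⟩
  choose δ hδ using hδ
  -- A reference distribution: `f` and `g` are bounded on the compact set of `(t, 0, m₀, u)`, and
  -- the Lipschitz bound reaches all other `(x, m)` at a cost of at most `L * (1 / 2 + 1)`.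
  let m₀ : P1 (Torus d) := P1.ofProb ⟨Measure.dirac 0, inferInstance⟩
  have hcont : ∀ t ∈ Icc 0 T, ∀ x m, Continuous fun u => (f t x m u, g t x m u) := by
    intro t ht x m
    have hι : Continuous fun u : U => ((t, x, m, u) : ℝ × Torus d × P1 (Torus d) × U) := by
      fun_prop
    exact (h.continuous_f.comp_continuous hι fun u => ⟨ht, mem_univ _⟩).prodMk
      (h.continuous_g.comp_continuous hι fun u => ⟨ht, mem_univ _⟩)
  obtain ⟨B, hB⟩ : ∃ B : ℝ, ∀ t ∈ Icc 0 T, ∀ u, ‖(f t 0 m₀ u, g t 0 m₀ u)‖ ≤ B := by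
    have hι : Continuous fun p : ℝ × U => ((p.1, 0, m₀, p.2) : ℝ × Torus d × P1 (Torus d) × U) := by
      fun_prop
    have hc : ContinuousOn (fun p : ℝ × U => (f p.1 0 m₀ p.2, g p.1 0 m₀ p.2))
        (Icc 0 T ×ˢ univ) :=
      (h.continuous_f.comp hι.continuousOn fun p hp => ⟨hp.1, mem_univ _⟩).prodMk
        (h.continuous_g.comp hι.continuousOn fun p hp => ⟨hp.1, mem_univ _⟩)
    obtain ⟨B, hB⟩ := (isCompact_Icc.prod isCompact_univ).exists_bound_of_continuousOn hc
    exact ⟨B, fun t ht u => hB (t, u) ⟨ht, mem_univ _⟩⟩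
  refine ⟨max (B + L * (1 / 2 + 1)) 0, L, fun ε => δ ε, le_max_right _ _, le_max_right _ _,
    fun ε hε => (hδ ε hε).1, fun t ht x m => isCompact_convexHull (isCompact_range (hcont t ht x m)),
    fun t _ x m => (range_nonempty _).convexHull, fun t ht x m v hv => ?_,
    fun ε hε t ht t' ht' htt x x' m m' => ?_⟩
  · have hsub : vectogram f g t x m ⊆ Metric.closedBall 0 (B + L * (1 / 2 + 1)) := by
      refine convexHull_min ?_ (convex_closedBall _ _)
      rintro _ ⟨u, rfl⟩
      rw [mem_closedBall_zero_iff]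
      have h1 := hL t ht x 0 m m₀ u
      have h2 : L * (‖x - 0‖ + P1.W1 m m₀) ≤ L * (1 / 2 + 1) :=
        mul_le_mul_of_nonneg_left (add_le_add (norm_torus_le _) (P1.W1_torus_le _ _))
          (le_max_right _ _)
      have h3 := norm_le_norm_add_norm_sub' (f t x m u, g t x m u) (f t 0 m₀ u, g t 0 m₀ u)
      linarith [hB t ht u]
    exact (mem_closedBall_zero_iff.1 (hsub hv)).trans (le_max_left _ _)
  · refine convexHull_range_near fun u => ?_
    have h1 := (hδ ε hε).2 t ht t' ht' htt x m u
    have h2 := hL t' ht' x x' m m' u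
    exact (norm_sub_le_norm_sub_add_norm_sub _ _ _).trans (add_le_add h1 h2)

/-- The field on `ℝᵈ × ℝ` lifted from the vectogram along a flow of distributions. -/
def field (f : ℝ → Torus d → P1 (Torus d) → U → (Fin d → ℝ))
    (g : ℝ → Torus d → P1 (Torus d) → U → ℝ) (m : ℝ → P1 (Torus d)) :
    ℝ → Ext d → Set (Ext d) := fun t ξ => vectogram f g t (toTorus ξ.1) (m t)

/-- The projection `ℝᵈ × ℝ → 𝕋ᵈ × ℝ`. -/
def cover (ξ : Ext d) : Torus d × ℝ := (toTorus ξ.1, ξ.2)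

theorem continuous_cover : Continuous (cover : Ext d → Torus d × ℝ) :=
  (continuous_toTorus.comp continuous_fst).prodMk continuous_snd

/-- Modulus of continuity in time of the field along an `M`-Lipschitz flow of distributions. -/
def flowModulus (M L : ℝ) (δ : ℝ → ℝ) (ε : ℝ) : ℝ := min (δ (ε / 2)) (ε / (2 * (L * M + 1)))

variable {M L : ℝ} {δ : ℝ → ℝ} {m m' : ℝ → P1 (Torus d)}

theorem VectogramBounds.isTame (h : VectogramBounds f g T M L δ)
    (hm : ∀ t t', P1.W1 (m t) (m t') ≤ M * |t - t'|) :
    IsTame T M L (flowModulus M L δ) (field f g m) where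
  M_nonneg := h.M_nonneg
  L_nonneg := h.L_nonneg
  δ_pos ε hε := by
    have := mul_nonneg h.L_nonneg h.M_nonneg
    exact lt_min (h.δ_pos _ (half_pos hε)) (by positivity)
  convex _ _ _ := convex_convexHull ℝ _
  compact t ht _ := h.compact t ht _ _
  nonempty t ht _ := h.nonempty t ht _ _
  norm_le t ht _ := h.norm_le t ht _ _
  near ε hε t ht t' ht' htt ξ ξ' v hv := by
    obtain ⟨v', hv', hle⟩ := h.near (ε / 2) (half_pos hε) t ht t' ht' (htt.trans (min_le_left _ _))
      _ (toTorus ξ'.1) _ (m t') v hv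
    refine ⟨v', hv', hle.trans ?_⟩
    have hLM := mul_nonneg h.L_nonneg h.M_nonneg
    have h1 : ‖toTorus ξ.1 - toTorus ξ'.1‖ ≤ ‖ξ - ξ'‖ :=
      (norm_toTorus_sub_le _ _).trans (norm_fst_le (ξ - ξ'))
    have h2 : |t - t'| ≤ ε / (2 * (L * M + 1)) := htt.trans (min_le_right _ _)
    rw [le_div_iff₀ (by positivity)] at h2
    have h3 := mul_le_mul_of_nonneg_left (add_le_add h1 (hm t t')) h.L_nonneg
    have := abs_nonneg (t - t')
    nlinarith

theorem fst_intervalIntegral {v : ℝ → Ext d} {a b : ℝ} (hv : IntervalIntegrable v volume a b) :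
    (∫ τ in a..b, v τ).1 = ∫ τ in a..b, (v τ).1 :=
  ((ContinuousLinearMap.fst ℝ (Fin d → ℝ) ℝ).intervalIntegral_comp_comm hv).symm

theorem snd_intervalIntegral {v : ℝ → Ext d} {a b : ℝ} (hv : IntervalIntegrable v volume a b) :
    (∫ τ in a..b, v τ).2 = ∫ τ in a..b, (v τ).2 :=
  ((ContinuousLinearMap.snd ℝ (Fin d → ℝ) ℝ).intervalIntegral_comp_comm hv).symm

variable {s r : ℝ}

/-- A solution of the differential inclusion lifts to an integral curve in `ℝᵈ × ℝ`, with any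
prescribed lift of its initial position and any prescribed initial value of the last coordinate. -/
theorem exists_lift_of_mem_SOL (hsT : s ≤ T) {w : Motion d s T} (hw : w ∈ SOL f g m hsT)
    {ξ : Ext d} (hξ : toTorus ξ.1 = (w ⟨s, left_mem_Icc.2 hsT⟩).1) :
    ∃ (W v : ℝ → Ext d), IntegrableOn v (Icc s T) ∧
      (∀ᵐ t : ℝ, t ∈ Icc s T → v t ∈ field f g m t (W t)) ∧
      (∀ t ∈ Icc s T, W t = W s + ∫ τ in s..t, v τ) ∧ W s = ξ ∧
      ∀ t : Icc s T, (w t).1 = toTorus (W t).1 ∧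
        (w t).2 - (w ⟨s, left_mem_Icc.2 hsT⟩).2 = (W t).2 - ξ.2 := by
  obtain ⟨v, hv, hae, hint⟩ := hw
  set W : ℝ → Ext d := fun t => ξ + ∫ τ in s..t, v τ with hWdef
  have hWs : W s = ξ := by simp [hWdef]
  have hvi : ∀ t ∈ Icc s T, IntervalIntegrable v volume s t := fun t ht =>
    (hv.mono_set (by rw [uIcc_of_le ht.1]; exact Icc_subset_Icc_right ht.2)).intervalIntegrable
  have hcov : ∀ t : Icc s T, (w t).1 = toTorus (W t).1 ∧
      (w t).2 - (w ⟨s, left_mem_Icc.2 hsT⟩).2 = (W t).2 - ξ.2 := by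
    intro t
    refine ⟨?_, ?_⟩
    · rw [(hint t).1, ← hξ, ← fst_intervalIntegral (hvi t t.2)]
      rfl
    · rw [(hint t).2, ← snd_intervalIntegral (hvi t t.2)]
      simp [hWdef]
  refine ⟨W, v, hv, ?_, fun t _ => by rw [hWs], hWs, hcov⟩
  filter_upwards [hae] with t ht hmem
  have := ht hmem
  rw [(hcov _).1] at this
  exact this

theorem exists_isTraj_of_mem_SOL (hG : IsTame T M L δ (field f g m)) (hs : 0 ≤ s) (hsT : s ≤ T)
    {w : Motion d s T} (hw : w ∈ SOL f g m hsT) {ξ : Ext d}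
    (hξ : toTorus ξ.1 = (w ⟨s, left_mem_Icc.2 hsT⟩).1) :
    ∃ W, IsTraj (field f g m) M s T W ∧ W s = ξ ∧ ∀ t : Icc s T, (w t).1 = toTorus (W t).1 ∧
        (w t).2 - (w ⟨s, left_mem_Icc.2 hsT⟩).2 = (W t).2 - ξ.2 := by
  obtain ⟨W, v, hv, hae, hint, hWs, hcov⟩ := exists_lift_of_mem_SOL hsT hw hξ
  exact ⟨W, hG.isTraj_of_integral hs hv hae hint, hWs, hcov⟩

/-- All solutions are `M`-Lipschitz. -/
theorem VectogramBounds.dist_le_of_mem_SOL (h : VectogramBounds f g T M L δ) (hs : 0 ≤ s)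
    (hsT : s ≤ T) {w : Motion d s T} (hw : w ∈ SOL f g m hsT) (a b : Icc s T) :
    dist (w a) (w b) ≤ M * |(a : ℝ) - b| := by
  obtain ⟨x, hx, -⟩ := exists_toTorus_eq (w ⟨s, left_mem_Icc.2 hsT⟩).1
  obtain ⟨W, v, hv, hae, hint, -, hcov⟩ := exists_lift_of_mem_SOL hsT hw (ξ := (x, 0)) hx
  have hbd : ∀ᵐ t : ℝ, t ∈ Icc s T → ‖v t‖ ≤ M := by
    filter_upwards [hae] with t ht hmem
    exact h.norm_le t (Icc_subset_Icc_left hs hmem) _ _ _ (ht hmem)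
  have hlip := (norm_sub_le_of_integral hv hbd hint).2 b b.2 a a.2
  refine le_trans ?_ hlip
  have ha := hcov a
  have hb := hcov b
  rw [Prod.dist_eq, ha.1, hb.1, dist_eq_norm, dist_eq_norm]
  refine max_le ((norm_toTorus_sub_le _ _).trans (norm_fst_le (W a - W b))) ?_
  have : (w a).2 - (w b).2 = (W a - W b).2 := by
    rw [Prod.snd_sub]
    linarith [ha.2, hb.2]
  rw [this]
  exact norm_snd_le _

theorem IsTraj.continuousOn {E : Type*} [NormedAddCommGroup E] [NormedSpace ℝ E]
    {G : ℝ → E → Set E} {W : ℝ → E} (hW : IsTraj G M s T W) : ContinuousOn W (Icc s T) := by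
  have : LipschitzOnWith M.toNNReal W (Icc s T) := by
    refine LipschitzOnWith.of_dist_le_mul fun a ha b hb => ?_
    rw [dist_eq_norm, Real.dist_eq]
    exact (hW.lip b hb a ha).trans
      (mul_le_mul_of_nonneg_right (Real.le_coe_toNNReal M) (abs_nonneg _))
  exact this.continuousOn

theorem mem_SOL_of_isTraj (hG : IsTame T M L δ (field f g m)) (hs : 0 ≤ s) (hsT : s ≤ T)
    {w : Motion d s T} {W : ℝ → Ext d} (hW : IsTraj (field f g m) M s T W)
    (hw : ∀ t : Icc s T, w t = cover (W t)) : w ∈ SOL f g m hsT := by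
  obtain ⟨v, hv, hae, hint⟩ := hW.exists_integral hsT hG.M_nonneg
    fun t ht => hG.compact t (Icc_subset_Icc_left hs ht)
  have hvi : ∀ t ∈ Icc s T, IntervalIntegrable v volume s t := fun t ht =>
    (hv.mono_set (by rw [uIcc_of_le ht.1]; exact Icc_subset_Icc_right ht.2)).intervalIntegrable
  refine ⟨v, hv, ?_, fun t => ?_⟩
  · filter_upwards [hae] with t ht hmem
    rw [hw]
    exact ht hmem
  · rw [hw, hw, hint t t.2, ← fst_intervalIntegral (hvi t t.2), ← snd_intervalIntegral (hvi t t.2)]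
    exact ⟨rfl, rfl⟩

/-- The motion covered by a trajectory. -/
def IsTraj.motion {G : ℝ → Ext d → Set (Ext d)} {W : ℝ → Ext d} (hW : IsTraj G M s T W) :
    Motion d s T :=
  ⟨fun t => cover (W t), continuous_cover.comp (continuousOn_iff_continuous_domRestrict.1 hW.continuousOn)⟩

/-- Comparison of the solutions for two flows of distributions, two initial times and two initial
states. -/
theorem VectogramBounds.exists_isTraj_near (h : VectogramBounds f g T M L δ)
    (hm : ∀ t t', P1.W1 (m t) (m t') ≤ M * |t - t'|)
    (hm' : ∀ t t', P1.W1 (m' t) (m' t') ≤ M * |t - t'|) {ρ : ℝ}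
    (hρ : ∀ t ∈ Icc 0 T, P1.W1 (m' t) (m t) ≤ ρ) (hs : s ∈ Icc 0 T) (hr : r ∈ Icc 0 T)
    {W : ℝ → Ext d} (hW : IsTraj (field f g m') M r T W) (ξ : Ext d) :
    ∃ X, IsTraj (field f g m) M s T X ∧ X s = ξ ∧
      ‖X T - W T‖ ≤ Real.exp (L * T) * (‖ξ - W r‖ + 3 * M * |s - r| + L * T * ρ) := by
  have hM := h.M_nonneg
  have hL := h.L_nonneg
  have hG := h.isTame hm
  have hG' := h.isTame hm'
  have hρ0 : 0 ≤ ρ := (dist_nonneg (x := m' s) (y := m s)).trans (hρ s hs)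
  set q := max s r
  -- `Z` is `W` frozen before `r`, so that it makes sense on `[s, T]` even if `s < r`. In `R`, the
  -- term with `min t q` pays for the frozen stretch and `L * ρ * t` for the change of flow.
  let Z : ℝ → Ext d := fun t => W (max t r)
  let R : ℝ → ℝ := fun t => 2 * M * min t q + L * ρ * t
  have hR : Monotone R := fun a b hab => by
    simp only [R]
    gcongr
  have hmax : ∀ t ∈ Icc s T, max t r ∈ Icc r T := fun t ht => ⟨le_max_right _ _, max_le ht.2 hr.2⟩
  have hlip : ∀ a ∈ Icc s T, ∀ b ∈ Icc s T, ‖Z b - Z a‖ ≤ M * |b - a| := fun a ha b hb =>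
    (hW.lip _ (hmax a ha) _ (hmax b hb)).trans
      (mul_le_mul_of_nonneg_left (abs_max_sub_max_le_abs _ _ _) hM)
  obtain ⟨X, hX, hXs, hXT⟩ := hG.exists_isTraj_near hs.1 hs.2 hR hlip (W := Z) (by
    intro ε hε
    have hε2 := half_pos hε
    refine ⟨min (stepSize M L (flowModulus M L δ) (ε / 2)) (flowModulus M L δ (ε / 2)),
      lt_min (hG.stepSize_pos hε2) (hG.δ_pos _ hε2), fun a b ha hab hb hba => ?_⟩
    have ha0 : a ∈ Icc 0 T := ⟨hs.1.trans ha, hab.trans hb⟩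
    have hstep := hba.trans (min_le_left _ _)
    have hmod := hba.trans (min_le_right _ _)
    have hRba : L * ρ * (b - a) ≤ R b - R a := by
      have : min a q ≤ min b q := min_le_min_right _ hab
      simp only [R]
      nlinarith
    by_cases hbr : b ≤ r
    · obtain ⟨v, hv⟩ := hG.nonempty a ha0 (Z a)
      refine ⟨v, hv, ?_⟩
      have e : Z b = Z a := by simp [Z, hbr, hab.trans hbr]
      have hbq : b ≤ q := hbr.trans (le_max_right _ _)
      rw [e, sub_self, zero_sub, norm_neg, norm_smul, Real.norm_of_nonneg (sub_nonneg.2 hab)]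
      have h1 := mul_le_mul_of_nonneg_left (hG.norm_le a ha0 _ v hv) (sub_nonneg.2 hab)
      have h2 : 0 ≤ ε * (b - a) := mul_nonneg hε.le (sub_nonneg.2 hab)
      have h3 : 0 ≤ L * ρ * (b - a) := mul_nonneg (mul_nonneg hL hρ0) (sub_nonneg.2 hab)
      have h4 : 0 ≤ (b - a) * M := mul_nonneg (sub_nonneg.2 hab) hM
      simp only [R, min_eq_left hbq, min_eq_left (hab.trans hbq)]
      linarith
    · push Not at hbr
      -- `Z` stands still on `[a, c]` and follows `W` on `[c, b]`; the two pieces are estimated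
      -- separately.
      set c := max a r with hc
      have hac : a ≤ c := le_max_left _ _
      have hcb : c ≤ b := max_le hab hbr.le
      have hcr : c ∈ Icc r T := ⟨le_max_right _ _, hcb.trans hb⟩
      have hc0 : c ∈ Icc 0 T := ⟨hr.1.trans hcr.1, hcr.2⟩
      obtain ⟨v', hv', hle'⟩ := hG'.slope_of_isTraj hr.1 hW hε2 hcr.1 hcb hb (by linarith)
      have hZb : Z b = W b := by simp [Z, hbr.le]
      have hZa : Z a = W c := rfl
      obtain ⟨v₁, hv₁, hle₁⟩ := hG'.near (ε / 2) hε2 c hc0 a ha0 (by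
        rw [abs_of_nonneg (sub_nonneg.2 hac)]; linarith) (W c) (W c) v' hv'
      obtain ⟨v, hv, hle⟩ : ∃ v ∈ field f g m a (Z a), ‖v₁ - v‖ ≤ L * ρ := by
        -- `h.near` leaves an arbitrary positive slack; intersecting the closed thickenings gives
        -- the bound `L * ρ` itself.
        have hnear : ∀ ε' > 0, v₁ ∈ Metric.cthickening (ε' + L * ρ) (field f g m a (Z a)) := by
          intro ε' hε'
          rw [mem_cthickening_iff_exists_norm_le (hG.compact a ha0 _) (by positivity)]
          obtain ⟨v, hv, hle⟩ := h.near ε' hε' a ha0 a ha0 (by simpa using (h.δ_pos _ hε').le) _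
            (toTorus (Z a).1) _ (m a) v₁ hv₁
          refine ⟨v, hv, hle.trans ?_⟩
          rw [hZa, sub_self, norm_zero, zero_add]
          gcongr
          exact hρ a ha0
        have hmem := Metric.cthickening_eq_iInter_cthickening (δ := L * ρ)
          (field f g m a (Z a))
        rw [← mem_cthickening_iff_exists_norm_le (hG.compact a ha0 _) (mul_nonneg hL hρ0), hmem]
        refine mem_iInter₂.2 fun ε' hε' => ?_
        have := hnear (ε' - L * ρ) (sub_pos.2 hε')
        rwa [sub_add_cancel] at this
      refine ⟨v, hv, ?_⟩
      have hvM := hG.norm_le a ha0 _ v hv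
      rw [hZb, hZa]
      have e : W b - W c - (b - a) • v = (W b - W c - (b - c) • v') +
          (b - c) • ((v' - v₁) + (v₁ - v)) - (c - a) • v := by
        have : (b - a) • v = (b - c) • v + (c - a) • v := by rw [← add_smul]; congr 1; ring
        rw [this, sub_add_sub_cancel, smul_sub]
        abel
      rw [sub_self, norm_zero, mul_zero, add_zero] at hle₁
      have hbc : 0 ≤ b - c := sub_nonneg.2 hcb
      have hca : 0 ≤ c - a := sub_nonneg.2 hac
      have h1 : ‖(b - c) • ((v' - v₁) + (v₁ - v))‖ ≤ (b - c) * (ε / 2 + L * ρ) := by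
        rw [norm_smul, Real.norm_of_nonneg hbc]
        exact mul_le_mul_of_nonneg_left ((norm_add_le _ _).trans (add_le_add hle₁ hle)) hbc
      have h2 : ‖(c - a) • v‖ ≤ (c - a) * M := by
        rw [norm_smul, Real.norm_of_nonneg hca]
        exact mul_le_mul_of_nonneg_left hvM hca
      have h3 : 2 * M * (c - a) + L * ρ * (b - a) ≤ R b - R a := by
        have hqb : c - a ≤ min b q - min a q := by
          rcases le_total a r with har | har
          · have : q = max s r := rfl
            have hsr : s ≤ r := ha.trans har
            rw [this, max_eq_right hsr, min_eq_right hbr.le, min_eq_left har, hc,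
              max_eq_right har]
          · have : min a q ≤ min b q := min_le_min_right _ hab
            rw [hc, max_eq_left har]
            linarith
        simp only [R]
        nlinarith
      rw [e]
      refine (norm_sub_le _ _).trans ((add_le_add_left (norm_add_le _ _) _).trans ?_)
      have h4 : 0 ≤ (c - a) * M := mul_nonneg hca hM
      have h5 : 0 ≤ L * ρ * (c - a) := mul_nonneg (mul_nonneg hL hρ0) hca
      have h6 : 0 ≤ ε * (c - a) := mul_nonneg hε.le hca
      linarith) ξ
  refine ⟨X, hX, hXs, ?_⟩
  have hZT : Z T = W T := by simp [Z, hr.2]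
  have hXT' := hXT T ⟨hs.2, le_rfl⟩
  rw [hZT] at hXT'
  have hqs : q - s ≤ |s - r| := by
    rcases le_total s r with hsr | hsr
    · simp only [q, max_eq_right hsr]
      rw [abs_sub_comm]; exact le_abs_self _
    · simp only [q, max_eq_left hsr, sub_self]
      exact abs_nonneg _
  have hqr : |q - r| ≤ |s - r| := by
    rcases le_total s r with hsr | hsr
    · simp [q, max_eq_right hsr]
    · simp [q, max_eq_left hsr]
  -- One `M * |s - r|` comes from moving the starting point along `W` when `r < s`; the other two
  -- come from the growth of `R`.
  have h1 : ‖ξ - Z s‖ ≤ ‖ξ - W r‖ + M * |s - r| := by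
    have h2 := hW.lip r ⟨le_rfl, hr.2⟩ q (hmax s ⟨le_rfl, hs.2⟩)
    have e : ξ - Z s = (ξ - W r) - (W q - W r) := by simp only [Z]; abel
    rw [e]
    exact (norm_sub_le _ _).trans (by gcongr; exact h2.trans (by gcongr))
  have h2 : R T - R s ≤ 2 * M * |s - r| + L * T * ρ := by
    have hsq : s ≤ q := le_max_left _ _
    have hqT : q ≤ T := max_le hs.2 hr.2
    simp only [R, min_eq_left hsq, min_eq_right hqT]
    have : 0 ≤ L * ρ * s := mul_nonneg (mul_nonneg hL hρ0) hs.1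
    nlinarith
  refine hXT'.trans ?_
  have hexp : Real.exp (L * (T - s)) ≤ Real.exp (L * T) :=
    Real.exp_le_exp.2 (mul_le_mul_of_nonneg_left (by linarith [hs.1]) hL)
  refine mul_le_mul hexp (by linarith) ?_ (Real.exp_pos _).le
  have := hR hs.2
  exact add_nonneg (norm_nonneg _) (sub_nonneg.2 this)

end Vectogram

/-! ### The value function and its dependence on the data. -/

section Value

variable {d : ℕ} {U : Type*} {T : ℝ}
  {f : ℝ → Torus d → P1 (Torus d) → U → (Fin d → ℝ)}
  {g : ℝ → Torus d → P1 (Torus d) → U → ℝ}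
  {σ : Torus d → P1 (Torus d) → ℝ}
  {M L : ℝ} {δ : ℝ → ℝ} {m m' : ℝ → P1 (Torus d)} {s r : ℝ} {y y' : Torus d}

/-- The payoffs of all trajectories on `[s, T]` which start at `y`. -/
def payoffs (f : ℝ → Torus d → P1 (Torus d) → U → (Fin d → ℝ))
    (g : ℝ → Torus d → P1 (Torus d) → U → ℝ) (σ : Torus d → P1 (Torus d) → ℝ) (M T : ℝ)
    (m : ℝ → P1 (Torus d)) (s : ℝ) (y : Torus d) : Set ℝ :=
  {c | ∃ W, IsTraj (field f g m) M s T W ∧ toTorus (W s).1 = y ∧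
    c = σ (toTorus (W T).1) (m T) + (W T).2 - (W s).2}

/-- The value function of the control problem along a flow of distributions. -/
def value (f : ℝ → Torus d → P1 (Torus d) → U → (Fin d → ℝ))
    (g : ℝ → Torus d → P1 (Torus d) → U → ℝ) (σ : Torus d → P1 (Torus d) → ℝ) (M T : ℝ)
    (m : ℝ → P1 (Torus d)) (s : ℝ) (y : Torus d) : ℝ := sSup (payoffs f g σ M T m s y)

/-- Motions lift to trajectories and trajectories project to motions. The payoff involves only the
increment of the last coordinate, so the lift may start with `0` there. -/
theorem image_Sol_eq_payoffs (hG : IsTame T M L δ (field f g m)) (hs : s ∈ Icc 0 T) :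
    (fun w : Motion d s T => σ (w ⟨T, right_mem_Icc.2 hs.2⟩).1 (m T) +
      (w ⟨T, right_mem_Icc.2 hs.2⟩).2 - (w ⟨s, left_mem_Icc.2 hs.2⟩).2) '' Sol f g m hs.2 y =
    payoffs f g σ M T m s y := by
  ext c
  constructor
  · rintro ⟨w, ⟨hw, hwy⟩, rfl⟩
    obtain ⟨x, hx, -⟩ := exists_toTorus_eq (w ⟨s, left_mem_Icc.2 hs.2⟩).1
    obtain ⟨W, hW, hWs, hcov⟩ := exists_isTraj_of_mem_SOL hG hs.1 hs.2 hw (ξ := (x, 0)) hx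
    refine ⟨W, hW, by rw [hWs, hx, hwy], ?_⟩
    have := hcov ⟨T, right_mem_Icc.2 hs.2⟩
    simp only [this.1, hWs]
    linarith [this.2]
  · rintro ⟨W, hW, hWy, rfl⟩
    exact ⟨hW.motion, ⟨mem_SOL_of_isTraj hG hs.1 hs.2 hW fun _ => rfl, hWy⟩, rfl⟩

/-- Filippov's theorem applied to a constant curve, whose velocity defect is at most `M`. -/
theorem payoffs_nonempty (hG : IsTame T M L δ (field f g m)) (hs : s ∈ Icc 0 T) :
    (payoffs f g σ M T m s y).Nonempty := by
  obtain ⟨x, hx, -⟩ := exists_toTorus_eq y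
  obtain ⟨W, hW, hWs, -⟩ := hG.exists_isTraj_near hs.1 hs.2 (W := fun _ => (x, 0))
    (R := fun t => M * t) (fun a b hab => mul_le_mul_of_nonneg_left hab hG.M_nonneg)
    (fun a _ b _ => by simpa using mul_nonneg hG.M_nonneg (abs_nonneg _))
    (fun ε hε => ⟨1, one_pos, fun a b ha hab hb _ => by
      have ha0 : a ∈ Icc 0 T := ⟨hs.1.trans ha, hab.trans hb⟩
      obtain ⟨v, hv⟩ := hG.nonempty a ha0 (x, 0)
      refine ⟨v, hv, ?_⟩
      have h0 := sub_nonneg.2 hab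
      rw [sub_self, zero_sub, norm_neg, norm_smul, Real.norm_of_nonneg h0]
      nlinarith [hG.norm_le a ha0 _ v hv]⟩) (x, 0)
  exact ⟨_, W, hW, by rw [hWs, hx], rfl⟩

theorem payoffs_bddAbove (hσ : Continuous fun p : Torus d × P1 (Torus d) => σ p.1 p.2)
    (hs : s ≤ T) : BddAbove (payoffs f g σ M T m s y) := by
  have hc : Continuous fun x => σ x (m T) := hσ.comp (by fun_prop : Continuous fun x => (x, m T))
  obtain ⟨B, hB⟩ := isCompact_univ.exists_bound_of_continuousOn hc.continuousOn
  refine ⟨B + M * |T - s|, ?_⟩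
  rintro _ ⟨W, hW, -, rfl⟩
  have h1 := hB (toTorus (W T).1) (mem_univ _)
  have h2 := (norm_snd_le (W T - W s)).trans (hW.lip s ⟨le_rfl, hs⟩ T ⟨hs, le_rfl⟩)
  rw [Prod.snd_sub] at h2
  have h3 := le_abs_self (σ (toTorus (W T).1) (m T))
  have h4 := le_abs_self ((W T).2 - (W s).2)
  rw [Real.norm_eq_abs] at h1 h2
  linarith

theorem isLUB_value (hG : IsTame T M L δ (field f g m))
    (hσ : Continuous fun p : Torus d × P1 (Torus d) => σ p.1 p.2) (hs : s ∈ Icc 0 T) :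
    IsLUB (payoffs f g σ M T m s y) (value f g σ M T m s y) :=
  isLUB_csSup (payoffs_nonempty hG hs) (payoffs_bddAbove hσ hs.2)

/-- The Lipschitz constant of the value function in all its arguments. -/
def valueLip (ϰ M L T : ℝ) : ℝ := (ϰ + 1) * (Real.exp (L * T) * (1 + 3 * M + L * T))

/-- Each trajectory `W` of the primed problem is shadowed by a trajectory of the other one, starting
at `W r` shifted by a short representative of `y - y'`. The endpoint error enters through `σ` with
factor `ϰ` and through `z` with factor `1`. As `σ` is merely continuous in the distribution, that
variation is kept apart as `κ`. -/
theorem value_le_value_add (h : VectogramBounds f g T M L δ)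
    (hσ : Continuous fun p : Torus d × P1 (Torus d) => σ p.1 p.2)
    {ϰ : ℝ} (hϰ : 0 ≤ ϰ) (hσϰ : ∀ x' x'' m, |σ x' m - σ x'' m| ≤ ϰ * ‖x' - x''‖)
    (hm : ∀ t t', P1.W1 (m t) (m t') ≤ M * |t - t'|)
    (hm' : ∀ t t', P1.W1 (m' t) (m' t') ≤ M * |t - t'|) {ρ κ : ℝ}
    (hρ : ∀ t ∈ Icc 0 T, P1.W1 (m' t) (m t) ≤ ρ)
    (hκ : ∀ x, |σ x (m T) - σ x (m' T)| ≤ κ) (hs : s ∈ Icc 0 T) (hr : r ∈ Icc 0 T) :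
    value f g σ M T m' r y' ≤ value f g σ M T m s y +
      (valueLip ϰ M L T * (‖y - y'‖ + |s - r| + ρ) + κ) := by
  have hM := h.M_nonneg
  have hL := h.L_nonneg
  have hT : 0 ≤ T := hs.1.trans hs.2
  have hρ0 : 0 ≤ ρ := (dist_nonneg (x := m' s) (y := m s)).trans (hρ s hs)
  refine csSup_le (payoffs_nonempty (h.isTame hm') hr) ?_
  rintro _ ⟨W, hW, hWr, rfl⟩
  obtain ⟨e, he, hen⟩ := exists_toTorus_eq (y - y')
  obtain ⟨X, hX, hXs, hXT⟩ := h.exists_isTraj_near hm hm' hρ hs hr hW ((W r).1 + e, (W r).2)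
  have hXmem : σ (toTorus (X T).1) (m T) + (X T).2 - (X s).2 ∈ payoffs f g σ M T m s y := by
    refine ⟨X, hX, ?_, rfl⟩
    rw [hXs, toTorus_add, he, hWr]
    abel
  have hle := le_csSup (payoffs_bddAbove hσ hs.2) hXmem
  have hnorm : ‖(((W r).1 + e, (W r).2) : Ext d) - W r‖ ≤ ‖y - y'‖ := by
    have : (((W r).1 + e, (W r).2) : Ext d) - W r = (e, 0) := Prod.ext (by simp) (by simp)
    rw [this]
    exact max_le hen (by simp)
  have hA : ‖X T - W T‖ ≤ Real.exp (L * T) * (1 + 3 * M + L * T) * (‖y - y'‖ + |s - r| + ρ) := by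
    refine hXT.trans ?_
    rw [mul_assoc (Real.exp _)]
    refine mul_le_mul_of_nonneg_left ?_ (Real.exp_pos _).le
    have h1 := norm_nonneg (y - y')
    have h2 := abs_nonneg (s - r)
    have h3 : 0 ≤ L * T := mul_nonneg hL hT
    nlinarith [mul_nonneg hM h1, mul_nonneg hM hρ0, mul_nonneg h3 h1, mul_nonneg h3 h2]
  have h1 := (abs_le.1 (hσϰ (toTorus (X T).1) (toTorus (W T).1) (m T))).1
  have h2 := (norm_toTorus_sub_le (X T).1 (W T).1).trans (norm_fst_le (X T - W T))
  have h3 := (abs_le.1 (hκ (toTorus (W T).1))).1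
  have h4 := norm_snd_le (X T - W T)
  rw [Prod.snd_sub, Real.norm_eq_abs] at h4
  have h5 := (abs_le.1 h4).1
  have h6 := mul_le_mul_of_nonneg_left h2 hϰ
  have h7 := mul_le_mul_of_nonneg_left hA (by linarith : 0 ≤ ϰ + 1)
  have h8 : (X s).2 = (W r).2 := by rw [hXs]
  rw [h8] at hle
  unfold value valueLip
  rw [mul_assoc]
  linarith

theorem abs_value_sub_value_le (h : VectogramBounds f g T M L δ)
    (hσ : Continuous fun p : Torus d × P1 (Torus d) => σ p.1 p.2)
    {ϰ : ℝ} (hϰ : 0 ≤ ϰ) (hσϰ : ∀ x' x'' m, |σ x' m - σ x'' m| ≤ ϰ * ‖x' - x''‖)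
    (hm : ∀ t t', P1.W1 (m t) (m t') ≤ M * |t - t'|)
    (hm' : ∀ t t', P1.W1 (m' t) (m' t') ≤ M * |t - t'|) {ρ κ : ℝ}
    (hρ : ∀ t ∈ Icc 0 T, P1.W1 (m' t) (m t) ≤ ρ)
    (hκ : ∀ x, |σ x (m T) - σ x (m' T)| ≤ κ) (hs : s ∈ Icc 0 T) (hr : r ∈ Icc 0 T) :
    |value f g σ M T m' r y' - value f g σ M T m s y| ≤
      valueLip ϰ M L T * (‖y - y'‖ + |s - r| + ρ) + κ := by
  have h1 := value_le_value_add (y := y) (y' := y') h hσ hϰ hσϰ hm hm' hρ hκ hs hr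
  have h2 := value_le_value_add (y := y') (y' := y) h hσ hϰ hσϰ hm' hm
    (fun t ht => (dist_comm (m t) (m' t)).le.trans (hρ t ht))
    (fun x => (abs_sub_comm _ _).le.trans (hκ x)) hr hs
  rw [norm_sub_rev y', abs_sub_comm r] at h2
  rw [abs_le]
  constructor <;> linarith

theorem continuousOn_value (h : VectogramBounds f g T M L δ)
    (hσ : Continuous fun p : Torus d × P1 (Torus d) => σ p.1 p.2)
    {ϰ : ℝ} (hϰ : 0 ≤ ϰ) (hσϰ : ∀ x' x'' m, |σ x' m - σ x'' m| ≤ ϰ * ‖x' - x''‖)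
    (hm : ∀ t t', P1.W1 (m t) (m t') ≤ M * |t - t'|) :
    ContinuousOn (fun p : ℝ × Torus d => value f g σ M T m p.1 p.2) (Icc 0 T ×ˢ univ) := by
  rintro ⟨s, y⟩ ⟨hs, -⟩
  simp only at hs
  rw [ContinuousWithinAt, tendsto_iff_dist_tendsto_zero]
  have hc : Continuous fun p : ℝ × Torus d =>
      valueLip ϰ M L T * (‖y - p.2‖ + |s - p.1| + 0) + 0 := by fun_prop
  have hlim : Tendsto (fun p : ℝ × Torus d =>
      valueLip ϰ M L T * (‖y - p.2‖ + |s - p.1| + 0) + 0) (𝓝[Icc 0 T ×ˢ univ] (s, y)) (𝓝 0) := by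
    have := hc.tendsto (s, y)
    simp only [sub_self, norm_zero, abs_zero, add_zero, mul_zero] at this
    simpa using this.mono_left nhdsWithin_le_nhds
  refine squeeze_zero' (Eventually.of_forall fun _ => dist_nonneg) ?_ hlim
  filter_upwards [self_mem_nhdsWithin] with p hp
  exact abs_value_sub_value_le h hσ hϰ hσϰ hm hm (fun t _ => (dist_self (m t)).le)
    (fun x => by simp) hs hp.1

/-- Currying turns `σ` into a continuous map into `C(Torus d, ℝ)`, where convergence is uniform by
compactness of the torus. -/
theorem eventually_forall_abs_sub_le {X : Type*} [TopologicalSpace X]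
    {σ : Torus d → X → ℝ} (hσ : Continuous fun p : Torus d × X => σ p.1 p.2) {ι : Type*}
    {l : Filter ι} {μ : ι → X} {ν : X} (hμ : Tendsto μ l (𝓝 ν)) {ε : ℝ} (hε : 0 < ε) :
    ∀ᶠ i in l, ∀ x, |σ x ν - σ x (μ i)| ≤ ε := by
  let F : C(X, C(Torus d, ℝ)) :=
    ContinuousMap.curry ⟨fun p : X × Torus d => σ p.2 p.1, hσ.comp continuous_swap⟩
  have h1 := Metric.tendsto_nhds.1 ((F.continuous.tendsto ν).comp hμ) ε hε
  filter_upwards [h1] with i hi x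
  rw [abs_sub_comm]
  exact (ContinuousMap.dist_apply_le_dist x).trans hi.le

/-- Convergence of the value functions along a convergent sequence of flows of distributions. -/
theorem eventually_abs_value_sub_value_le (h : VectogramBounds f g T M L δ)
    (hσ : Continuous fun p : Torus d × P1 (Torus d) => σ p.1 p.2)
    {ϰ : ℝ} (hϰ : 0 ≤ ϰ) (hσϰ : ∀ x' x'' m, |σ x' m - σ x'' m| ≤ ϰ * ‖x' - x''‖)
    (hm : ∀ t t', P1.W1 (m t) (m t') ≤ M * |t - t'|) {ι : Type*} {l : Filter ι}
    {mi : ι → ℝ → P1 (Torus d)} (hmi : ∀ i t t', P1.W1 (mi i t) (mi i t') ≤ M * |t - t'|)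
    {ρ : ι → ℝ} (hρ : ∀ i, ∀ t ∈ Icc 0 T, P1.W1 (mi i t) (m t) ≤ ρ i) (hρ0 : Tendsto ρ l (𝓝 0))
    (hs : s ∈ Icc 0 T) {si : ι → ℝ} (hsi : ∀ i, si i ∈ Icc 0 T) (hlim : Tendsto si l (𝓝 s))
    {ε : ℝ} (hε : 0 < ε) :
    ∀ᶠ i in l, ∀ y y', |value f g σ M T (mi i) (si i) y' - value f g σ M T m s y| ≤
      valueLip ϰ M L T * ‖y - y'‖ + ε := by
  have hT : T ∈ Icc 0 T := ⟨hs.1.trans hs.2, le_rfl⟩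
  have h1 : Tendsto (fun i => mi i T) l (𝓝 (m T)) := by
    rw [tendsto_iff_dist_tendsto_zero]
    exact squeeze_zero (fun _ => dist_nonneg) (fun i => hρ i T hT) hρ0
  have h2 : Tendsto (fun i => valueLip ϰ M L T * (|s - si i| + ρ i)) l (𝓝 0) := by
    have := (((hlim.const_sub s).abs.add hρ0).const_mul (valueLip ϰ M L T))
    simpa using this
  filter_upwards [eventually_forall_abs_sub_le hσ h1 (half_pos hε),
    h2.eventually_le_const (half_pos hε)] with i hi1 hi2 y y'
  have := abs_value_sub_value_le (y := y) (y' := y') h hσ hϰ hσϰ hm (hmi i) (hρ i) hi1 hs (hsi i)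
  linarith

end Value

/-! ### Compactness of `P1` over a compact space, and supports of limits. -/

namespace P1

variable {X Y : Type*} [MetricSpace X] [MeasurableSpace X] [BorelSpace X]
  [MetricSpace Y] [MeasurableSpace Y] [BorelSpace Y]

/-- The image of a probability under a `1`-Lipschitz map. -/
def map {h : X → Y} (hh : LipschitzWith 1 h) (m : P1 X) : P1 Y where
  prob := m.prob.map hh.continuous.measurable.aemeasurable
  moment := by
    obtain ⟨x₀, -⟩ := m.moment
    refine ⟨h x₀, ?_⟩
    have hd : Continuous fun y : Y => dist y (h x₀) := by fun_prop
    rw [ProbabilityMeasure.toMeasure_map, integrable_map_measure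
      hd.measurable.aestronglyMeasurable hh.continuous.measurable.aemeasurable]
    refine (m.integrable_dist x₀).mono'
      (hd.comp hh.continuous).measurable.aestronglyMeasurable (Eventually.of_forall fun x => ?_)
    simpa using hh.dist_le_mul x x₀

theorem measure_map {h : X → Y} (hh : LipschitzWith 1 h) (m : P1 X) :
    (m.map hh).measure = m.measure.map h :=
  ProbabilityMeasure.toMeasure_map _ hh.continuous.measurable.aemeasurable

theorem W1_map_le {h : X → Y} (hh : LipschitzWith 1 h) (m₁ m₂ : P1 X) :
    W1 (m₁.map hh) (m₂.map hh) ≤ W1 m₁ m₂ := by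
  refine W1_le fun φ hφ => ?_
  rw [measure_map, measure_map, integral_map hh.continuous.measurable.aemeasurable
    hφ.continuous.measurable.aestronglyMeasurable,
    integral_map hh.continuous.measurable.aemeasurable
    hφ.continuous.measurable.aestronglyMeasurable]
  exact le_W1 m₁ m₂ (φ := fun x => φ (h x)) (by simpa [Function.comp_def] using hφ.comp hh)

/-- On a compact space the Kantorovich–Rubinstein distance is controlled by the
Lévy–Prokhorov distance. -/
theorem W1_le_of_levyProkhorovEDist_lt [CompactSpace X] (m₁ m₂ : P1 X) {ε : ℝ} (hε : 0 < ε)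
    (h : levyProkhorovEDist m₁.measure m₂.measure < ENNReal.ofReal ε) :
    W1 m₁ m₂ ≤ ε * (1 + 2 * Metric.diam (univ : Set X)) := by
  refine W1_le fun φ hφ => ?_
  obtain ⟨x₀, -⟩ := m₁.moment
  set D := Metric.diam (univ : Set X)
  have hφD : ∀ x, |φ x - φ x₀| ≤ D := fun x => by
    have h1 := hφ.dist_le_mul x x₀
    rw [Real.dist_eq, NNReal.coe_one, one_mul] at h1
    exact h1.trans (Metric.dist_le_diam_of_mem isCompact_univ.isBounded (mem_univ _) (mem_univ _))
  have hψc : Continuous fun x => φ x - (φ x₀ - D) := hφ.continuous.sub continuous_const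
  -- `ψ` is `φ` shifted to be nonnegative and `ψ' = ψ + ε`. By the Lipschitz bound, the
  -- `ε`-thickening of a superlevel set of `ψ` lies in that of `ψ'`, so the layer-cake formula
  -- compares the integrals.
  let ψ : BoundedContinuousFunction X ℝ := BoundedContinuousFunction.mkOfCompact ⟨_, hψc⟩
  let ψ' : BoundedContinuousFunction X ℝ :=
    BoundedContinuousFunction.mkOfCompact ⟨_, hψc.add (continuous_const (y := ε))⟩
  have hψ : ∀ x, ψ x = φ x - (φ x₀ - D) := fun x => rfl
  have hψ' : ∀ x, ψ' x = ψ x + ε := fun x => rfl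
  have hψ0 : ∀ x, 0 ≤ ψ x := fun x => by
    rw [hψ]; linarith [(abs_le.1 (hφD x)).1]
  have hψ2 : ‖ψ‖ ≤ 2 * D := by
    refine (BoundedContinuousFunction.norm_le (by positivity)).2 fun x => ?_
    rw [Real.norm_of_nonneg (hψ0 x), hψ]
    linarith [(abs_le.1 (hφD x)).2]
  have hnorm : ‖ψ‖ ≤ ‖ψ'‖ := by
    refine (BoundedContinuousFunction.norm_le (norm_nonneg _)).2 fun x => ?_
    refine le_trans ?_ (ψ'.norm_coe_le_norm x)
    rw [Real.norm_of_nonneg (hψ0 x), hψ', Real.norm_of_nonneg (by linarith [hψ0 x])]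
    linarith
  have key := BoundedContinuousFunction.integral_le_of_levyProkhorovEDist_lt m₁.measure m₂.measure
    hε h ψ (Eventually.of_forall hψ0)
  have hanti : Antitone fun t : ℝ => m₂.measure.real {a : X | t ≤ ψ' a} := fun s t hst =>
    measureReal_mono fun x hx => hst.trans hx
  have hint : IntegrableOn (fun t : ℝ => m₂.measure.real {a : X | t ≤ ψ' a}) (Ioc 0 ‖ψ'‖) :=
    ((hanti.antitoneOn _).integrableOn_isCompact isCompact_Icc).mono_set Ioc_subset_Icc_self
  have hsub : ∀ t, Metric.thickening ε {a | t ≤ ψ a} ⊆ {a | t ≤ ψ' a} := by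
    intro t x hx
    obtain ⟨z, hz, hxz⟩ := Metric.mem_thickening_iff.1 hx
    have h1 := hφ.dist_le_mul x z
    rw [Real.dist_eq, NNReal.coe_one, one_mul] at h1
    have h2 : t ≤ φ z - (φ x₀ - D) := hz
    show t ≤ φ x - (φ x₀ - D) + ε
    linarith [(abs_le.1 h1).1]
  have h1 : ∫ t in Ioc 0 ‖ψ‖, m₂.measure.real (Metric.thickening ε {a | t ≤ ψ a}) ≤
      ∫ x, ψ' x ∂m₂.measure := by
    rw [BoundedContinuousFunction.integral_eq_integral_meas_le ψ' m₂.measure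
      (Eventually.of_forall fun x => by
        show 0 ≤ ψ' x
        rw [hψ']; linarith [hψ0 x])]
    refine (integral_mono_of_nonneg (Eventually.of_forall fun _ => measureReal_nonneg)
      (hint.mono_set (Ioc_subset_Ioc_right hnorm))
      (Eventually.of_forall fun t => measureReal_mono (hsub t))).trans ?_
    exact setIntegral_mono_set hint (Eventually.of_forall fun _ => measureReal_nonneg)
      (Ioc_subset_Ioc_right hnorm).eventuallyLE
  have e1 : ∫ x, ψ x ∂m₁.measure = (∫ x, φ x ∂m₁.measure) - (φ x₀ - D) := by
    simp only [hψ]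
    rw [integral_sub (m₁.integrable_lip hφ) (integrable_const _)]
    simp
  have e2 : ∫ x, ψ' x ∂m₂.measure = (∫ x, φ x ∂m₂.measure) - (φ x₀ - D) + ε := by
    simp only [hψ', hψ]
    rw [integral_add (f := fun x => φ x - (φ x₀ - D))
      ((m₂.integrable_lip hφ).sub (integrable_const _)) (integrable_const _),
      integral_sub (m₂.integrable_lip hφ) (integrable_const _)]
    simp
  have h3 := mul_le_mul_of_nonneg_left hψ2 hε.le
  linarith

/-- On a compact space, `P1` is sequentially compact. -/
theorem exists_subseq_tendsto [CompactSpace X] (μ : ℕ → P1 X) :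
    ∃ (ν : P1 X) (k : ℕ → ℕ), StrictMono k ∧ Tendsto (fun i => W1 (μ (k i)) ν) atTop (𝓝 0) := by
  obtain ⟨ν, k, hk, hlim⟩ := CompactSpace.tendsto_subseq fun i => (μ i).prob
  refine ⟨ofProb ν, k, hk, ?_⟩
  have h1 := (LevyProkhorov.continuous_ofMeasure_probabilityMeasure.tendsto ν).comp hlim
  rw [tendsto_iff_edist_tendsto_0] at h1
  rw [Metric.tendsto_atTop']
  intro ε hε
  set C := 1 + 2 * Metric.diam (univ : Set X)
  have hC : 0 < C := by
    have := Metric.diam_nonneg (s := (univ : Set X))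
    positivity
  have hη : 0 < ε / (2 * C) := by positivity
  have h2 := h1.eventually_lt_const (ENNReal.ofReal_pos.2 hη)
  obtain ⟨N, hN⟩ := eventually_atTop.1 h2
  refine ⟨N, fun n hn => ?_⟩
  have h3 := W1_le_of_levyProkhorovEDist_lt (μ (k n)) (ofProb ν) hη (hN n hn.le)
  have h4 : 0 ≤ W1 (μ (k n)) (ofProb ν) := dist_nonneg (x := μ (k n)) (y := ofProb ν)
  rw [Real.dist_eq, sub_zero, abs_of_nonneg h4]
  refine h3.trans_lt ?_
  have : ε / (2 * C) * C = ε / 2 := by field_simp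
  rw [this]
  linarith

/-- A point of the support of a limit is approximated by generic values of random elements with the
converging laws. -/
theorem eventually_exists_dist_lt {μ : ℕ → P1 X} {ν : P1 X}
    (hμ : Tendsto (fun i => W1 (μ i) ν) atTop (𝓝 0)) {x : X} (hx : x ∈ ν.measure.support)
    {Ω : ℕ → Type*} [∀ i, MeasurableSpace (Ω i)] {P : ∀ i, Measure (Ω i)}
    {N : ∀ i, Ω i → X} (hN : ∀ i, Measurable (N i)) (hlaw : ∀ i, (μ i).measure = (P i).map (N i))
    {A : ∀ i, Set (Ω i)} (hA : ∀ i, A i ∈ ae (P i)) {ε : ℝ} (hε : 0 < ε) :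
    ∀ᶠ i in atTop, ∃ ω ∈ A i, dist (N i ω) x < ε := by
  -- A `1`-Lipschitz tent at `x`. Its integral against the limit is positive because `x` is in the
  -- support, hence eventually positive against `μ i`; it would vanish if no generic value came
  -- within `ε`.
  let φ : X → ℝ := fun y => max (ε - dist y x) 0
  have hφ : LipschitzWith 1 φ := by
    refine LipschitzWith.max_const (LipschitzWith.of_dist_le_mul fun y z => ?_) 0
    rw [Real.dist_eq, NNReal.coe_one, one_mul, sub_sub_sub_cancel_left, abs_sub_comm]
    exact abs_dist_sub_le y z x
  have hφ0 : ∀ y, 0 ≤ φ y := fun y => le_max_right _ _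
  have hpos : 0 < ∫ y, φ y ∂ν.measure := by
    rw [integral_pos_iff_support_of_nonneg hφ0 (ν.integrable_lip hφ)]
    refine (Measure.mem_support_iff_forall x).1 hx _ ?_
    filter_upwards [Metric.ball_mem_nhds x hε] with y hy
    have : 0 < ε - dist y x := sub_pos.2 hy
    exact (lt_max_of_lt_left this).ne'
  filter_upwards [hμ.eventually_lt_const hpos] with i hi
  have h1 := le_W1 ν (μ i) hφ
  have h2 : W1 ν (μ i) = W1 (μ i) ν := dist_comm ν (μ i)
  have h3 : 0 < ∫ y, φ y ∂(μ i).measure := by linarith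
  rw [hlaw i, integral_map (hN i).aemeasurable hφ.continuous.measurable.aestronglyMeasurable] at h3
  by_contra! hcon
  have h4 : ∫ ω, φ (N i ω) ∂P i = 0 := by
    refine integral_eq_zero_of_ae ?_
    filter_upwards [hA i] with ω hω
    exact max_eq_right (sub_nonpos.2 (hcon ω hω))
  exact h3.ne' h4

end P1

/-! ### Compact sets of motions and the change of time interval. -/

section CompactMotions

variable {d : ℕ} {s T : ℝ}

/-- The `M`-Lipschitz motions whose last coordinate is bounded by `C`. -/
def lipMotions (d : ℕ) (s T M C : ℝ) : Set (Motion d s T) :=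
  {w | (∀ a b : Icc s T, dist (w a) (w b) ≤ M * |(a : ℝ) - b|) ∧ ∀ a, |(w a).2| ≤ C}

theorem isCompact_lipMotions {M : ℝ} (C : ℝ) : IsCompact (lipMotions d s T M C) := by
  have hlip : ∀ h : Icc s T → Torus d × ℝ, (∀ a b, dist (h a) (h b) ≤ M * |(a : ℝ) - b|) →
      LipschitzWith M.toNNReal h := fun h hh => LipschitzWith.of_dist_le_mul fun a b =>
    (hh a b).trans (mul_le_mul_of_nonneg_right (Real.le_coe_toNNReal M) (abs_nonneg _))
  refine ArzelaAscoli.isCompact_of_equicontinuous _ ?_ ?_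
  · have e : ContinuousMap.toFun '' lipMotions d s T M C =
        {h : Icc s T → Torus d × ℝ | (∀ a b, dist (h a) (h b) ≤ M * |(a : ℝ) - b|) ∧
          ∀ a, |(h a).2| ≤ C} := by
      ext h
      constructor
      · rintro ⟨w, hw, rfl⟩
        exact hw
      · intro hh
        exact ⟨⟨h, (hlip h hh.1).continuous⟩, hh, rfl⟩
    rw [e]
    refine (isCompact_univ_pi fun _ : Icc s T =>
      (isCompact_univ (X := Torus d)).prod (isCompact_Icc (a := -C) (b := C))).of_isClosed_subset
      ?_ fun h hh a _ => ⟨mem_univ _, abs_le.1 (hh.2 a)⟩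
    have e' : {h : Icc s T → Torus d × ℝ | (∀ a b, dist (h a) (h b) ≤ M * |(a : ℝ) - b|) ∧
          ∀ a, |(h a).2| ≤ C} =
        (⋂ (a : Icc s T) (b : Icc s T), {h | dist (h a) (h b) ≤ M * |(a : ℝ) - b|}) ∩
          ⋂ a : Icc s T, {h | |(h a).2| ≤ C} := by
      ext
      simp only [mem_ofPred_eq, mem_inter_iff, mem_iInter]
    rw [e']
    exact (isClosed_iInter fun a => isClosed_iInter fun b =>
        isClosed_le (by fun_prop) continuous_const).inter
      (isClosed_iInter fun a => isClosed_le (by fun_prop) continuous_const)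
  · have h1 : UniformEquicontinuous ((↑) : lipMotions d s T M C → Icc s T → Torus d × ℝ) :=
      LipschitzWith.uniformEquicontinuous _ M.toNNReal fun w => hlip _ w.2.1
    exact h1.equicontinuous

theorem lipschitzWith_eval_fst (a : Icc s T) :
    LipschitzWith 1 fun w : Motion d s T => (w a).1 :=
  LipschitzWith.of_dist_le_mul fun w w' => by
    rw [NNReal.coe_one, one_mul]
    exact (le_max_left _ _).trans (ContinuousMap.dist_apply_le_dist (f := w) (g := w') a)

/-- A motion on `[t, T]`, transferred to `[s, T]` by freezing it before `t`, with the last coordinate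
normalized to vanish at time `t`. -/
def transfer {t : ℝ} (s : ℝ) (ht : t ≤ T) (w : Motion d t T) : Motion d s T :=
  ⟨fun τ => ((w (projIcc t T ht τ)).1, (w (projIcc t T ht τ)).2 - (w ⟨t, left_mem_Icc.2 ht⟩).2), by
    have : Continuous fun τ : Icc s T => w (projIcc t T ht τ) :=
      w.continuous.comp (continuous_projIcc.comp continuous_subtype_val)
    exact this.fst.prodMk (this.snd.sub continuous_const)⟩

theorem continuous_transfer {t : ℝ} (s : ℝ) (ht : t ≤ T) :
    Continuous (transfer s ht : Motion d t T → Motion d s T) := by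
  refine ContinuousMap.continuous_of_continuous_uncurry _ ?_
  have h1 : Continuous fun p : Motion d t T × Icc s T => p.1 (projIcc t T ht p.2) :=
    continuous_fst.eval (continuous_projIcc.comp (continuous_subtype_val.comp continuous_snd))
  have h2 : Continuous fun p : Motion d t T × Icc s T => p.1 ⟨t, left_mem_Icc.2 ht⟩ :=
    continuous_fst.eval continuous_const
  exact h1.fst.prodMk (h1.snd.sub h2.snd)

end CompactMotions

/-- The measure `χ` itself couples the two images. -/
theorem P1.W1_map_map_le {X Y : Type*} [MetricSpace X] [MeasurableSpace X] [BorelSpace X]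
    [MetricSpace Y] [MeasurableSpace Y] [BorelSpace Y] {h h' : X → Y} (hh : LipschitzWith 1 h)
    (hh' : LipschitzWith 1 h') (χ : P1 X) {C : ℝ} (hC : ∀ᵐ x ∂χ.measure, dist (h x) (h' x) ≤ C) :
    P1.W1 (χ.map hh) (χ.map hh') ≤ C := by
  refine P1.W1_le fun φ hφ => ?_
  rw [P1.measure_map, P1.measure_map, integral_map hh.continuous.measurable.aemeasurable
    hφ.continuous.measurable.aestronglyMeasurable,
    integral_map hh'.continuous.measurable.aemeasurable
    hφ.continuous.measurable.aestronglyMeasurable]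
  have i1 : Integrable (fun x => φ (h x)) χ.measure :=
    χ.integrable_lip (K := 1) (by simpa [Function.comp_def] using hφ.comp hh)
  have i2 : Integrable (fun x => φ (h' x)) χ.measure :=
    χ.integrable_lip (K := 1) (by simpa [Function.comp_def] using hφ.comp hh')
  rw [← integral_sub i1 i2]
  refine (integral_mono_ae (i1.sub i2) (integrable_const C) ?_).trans (by simp)
  filter_upwards [hC] with x hx
  have h1 := hφ.dist_le_mul (h x) (h' x)
  rw [Real.dist_eq, NNReal.coe_one, one_mul] at h1
  exact (le_abs_self _).trans (h1.trans hx)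

/-! ### Equilibria and compactness of the set of solutions. -/

section Flow

variable {d : ℕ} {U : Type*} {T : ℝ}
  {f : ℝ → Torus d → P1 (Torus d) → U → (Fin d → ℝ)}
  {g : ℝ → Torus d → P1 (Torus d) → U → ℝ}
  {σ : Torus d → P1 (Torus d) → ℝ}
  {M L : ℝ} {δ : ℝ → ℝ} {m m' : ℝ → P1 (Torus d)} {t₀ : ℝ}

theorem SOL_congr {s r : ℝ} (hsr : s ≤ r) (hm : ∀ t ∈ Icc s r, m t = m' t) :
    SOL f g m hsr = SOL f g m' hsr := by
  have aux : ∀ {m₁ m₂ : ℝ → P1 (Torus d)}, (∀ t ∈ Icc s r, m₁ t = m₂ t) →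
      SOL f g m₁ hsr ⊆ SOL f g m₂ hsr := by
    rintro m₁ m₂ h w ⟨v, hv, hae, hint⟩
    refine ⟨v, hv, ?_, hint⟩
    filter_upwards [hae] with t ht hmem
    rw [← h t hmem]
    exact ht hmem
  exact (aux hm).antisymm (aux fun t ht => (hm t ht).symm)

/-- The flow of the position laws under a distribution of motions, frozen outside `[t₀, T]`. -/
def flow (ht₀ : t₀ ≤ T) (χ : P1 (Motion d t₀ T)) : ℝ → P1 (Torus d) := fun τ =>
  χ.map (lipschitzWith_eval_fst (projIcc t₀ T ht₀ τ))

/-- A distribution `χ` of motions on `[t₀, T]` which generates a solution of the mean field game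
whose flow of distributions, extended to `ℝ`, is `m` and whose value function is `value m`. -/
structure IsEquilibrium (f : ℝ → Torus d → P1 (Torus d) → U → (Fin d → ℝ))
    (g : ℝ → Torus d → P1 (Torus d) → U → ℝ) (σ : Torus d → P1 (Torus d) → ℝ) (M : ℝ)
    (ht₀ : t₀ ≤ T) (χ : P1 (Motion d t₀ T)) : Prop where
  lip : ∀ a b, P1.W1 (flow ht₀ χ a) (flow ht₀ χ b) ≤ M * |a - b|
  supp : χ.measure.support ⊆ SOL f g (flow ht₀ χ) ht₀
  const : ∀ s r : Icc t₀ T, ∀ w ∈ χ.measure.support,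
    value f g σ M T (flow ht₀ χ) s (w s).1 + (w s).2 =
      value f g σ M T (flow ht₀ χ) r (w r).1 + (w r).2

theorem flow_projIcc (ht₀ : t₀ ≤ T) (χ : P1 (Motion d t₀ T)) (τ : ℝ) :
    flow ht₀ χ (projIcc t₀ T ht₀ τ) = flow ht₀ χ τ := by
  simp only [flow, projIcc_val]

theorem measure_flow (ht₀ : t₀ ≤ T) (χ : P1 (Motion d t₀ T)) (τ : Icc t₀ T) :
    (flow ht₀ χ τ).measure = χ.measure.map fun w => (w τ).1 := by
  simp only [flow, P1.measure_map, projIcc_val]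

theorem abs_projIcc_sub_le (ht₀ : t₀ ≤ T) (a b : ℝ) :
    |(projIcc t₀ T ht₀ a : ℝ) - projIcc t₀ T ht₀ b| ≤ |a - b| := by
  rw [← Real.dist_eq, ← Real.dist_eq, ← Subtype.dist_eq]
  simpa using (LipschitzWith.projIcc ht₀).dist_le_mul a b

/-- Every solution of the mean field game comes from an equilibrium. -/
theorem IsSolution.exists_isEquilibrium (h : VectogramBounds f g T M L δ)
    (ht₀ : t₀ ∈ Icc 0 T) {V : ℝ → Torus d → ℝ} (hV : IsSolution f g σ T t₀ ht₀.2 V m) :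
    ∃ χ : P1 (Motion d t₀ T), IsEquilibrium f g σ M ht₀.2 χ ∧ m t₀ = flow ht₀.2 χ t₀ ∧
      ∀ s ∈ Icc t₀ T, ∀ y, V s y = value f g σ M T (flow ht₀.2 χ) s y := by
  obtain ⟨-, -, χ, hlaw, hLUB, hsupp, hconst⟩ := hV
  have hflow : ∀ τ ∈ Icc t₀ T, m τ = flow ht₀.2 χ τ := fun τ hτ =>
    P1.ext_measure ((hlaw ⟨τ, hτ⟩).trans (measure_flow ht₀.2 χ ⟨τ, hτ⟩).symm)
  have hlip : ∀ a b, P1.W1 (flow ht₀.2 χ a) (flow ht₀.2 χ b) ≤ M * |a - b| := by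
    intro a b
    refine (P1.W1_map_map_le _ _ χ (C := M * |(projIcc t₀ T ht₀.2 a : ℝ) - projIcc t₀ T ht₀.2 b|)
      ?_).trans (mul_le_mul_of_nonneg_left (abs_projIcc_sub_le _ _ _) h.M_nonneg)
    -- Almost every motion lies in the support, hence is a solution and `M`-Lipschitz.
    filter_upwards [Measure.support_mem_ae] with w hw
    exact (le_max_left _ _).trans (h.dist_le_of_mem_SOL ht₀.1 ht₀.2 (hsupp hw) _ _)
  have hval : ∀ s ∈ Icc t₀ T, ∀ y, V s y = value f g σ M T (flow ht₀.2 χ) s y := by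
    intro s hs y
    have hs0 : s ∈ Icc 0 T := ⟨ht₀.1.trans hs.1, hs.2⟩
    have h1 := hLUB s hs y
    have h2 : Sol f g m hs.2 y = Sol f g (flow ht₀.2 χ) hs.2 y := by
      simp only [Sol]
      rw [SOL_congr hs.2 fun t ht => hflow t ⟨hs.1.trans ht.1, ht.2⟩]
    rw [h2, hflow T ⟨ht₀.2, le_rfl⟩, image_Sol_eq_payoffs (h.isTame hlip) hs0] at h1
    exact h1.csSup_eq (payoffs_nonempty (h.isTame hlip) hs0) |>.symm
  refine ⟨χ, ⟨hlip, ?_, ?_⟩, hflow t₀ ⟨le_rfl, ht₀.2⟩, hval⟩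
  · rw [← SOL_congr ht₀.2 hflow]
    exact hsupp
  · intro s r w hw
    rw [← hval s s.2, ← hval r r.2]
    rcases lt_trichotomy s r with hsr | rfl | hsr
    · exact hconst s r hsr w hw
    · rfl
    · exact (hconst r s hsr w hw).symm

theorem IsEquilibrium.isSolution (h : VectogramBounds f g T M L δ)
    (hσ : Continuous fun p : Torus d × P1 (Torus d) => σ p.1 p.2)
    {ϰ : ℝ} (hϰ : 0 ≤ ϰ) (hσϰ : ∀ x' x'' m, |σ x' m - σ x'' m| ≤ ϰ * ‖x' - x''‖)
    (ht₀ : t₀ ∈ Icc 0 T) {χ : P1 (Motion d t₀ T)} (hχ : IsEquilibrium f g σ M ht₀.2 χ) :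
    IsSolution f g σ T t₀ ht₀.2 (value f g σ M T (flow ht₀.2 χ)) (flow ht₀.2 χ) := by
  have hG := h.isTame hχ.lip
  refine ⟨(continuousOn_value h hσ hϰ hσϰ hχ.lip).mono
      (prod_mono (Icc_subset_Icc_left ht₀.1) subset_rfl), ?_, χ, measure_flow ht₀.2 χ, ?_, hχ.supp,
    fun s r _ => hχ.const s r⟩
  · have : LipschitzWith M.toNNReal (flow ht₀.2 χ) := LipschitzWith.of_dist_le_mul fun a b =>
      (hχ.lip a b).trans (mul_le_mul_of_nonneg_right (Real.le_coe_toNNReal M) (abs_nonneg _))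
    exact (this.continuous.comp continuous_subtype_val).measurable
  · intro s hs y
    have hs0 : s ∈ Icc 0 T := ⟨ht₀.1.trans hs.1, hs.2⟩
    rw [image_Sol_eq_payoffs hG hs0]
    exact isLUB_value hG hσ hs0

/-- The solution sets are closed under joint limits of initial times, flows of distributions and
motions. -/
theorem VectogramBounds.mem_SOL_of_tendsto (h : VectogramBounds f g T M L δ)
    (hm : ∀ t t', P1.W1 (m t) (m t') ≤ M * |t - t'|) {mi : ℕ → ℝ → P1 (Torus d)}
    (hmi : ∀ i t t', P1.W1 (mi i t) (mi i t') ≤ M * |t - t'|)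
    {ρ : ℕ → ℝ} (hρ : ∀ i, ∀ t ∈ Icc 0 T, P1.W1 (mi i t) (m t) ≤ ρ i)
    (hρ0 : Tendsto ρ atTop (𝓝 0)) (ht₀ : t₀ ∈ Icc 0 T) {ti : ℕ → ℝ} (hti : ∀ i, ti i ∈ Icc 0 T)
    (hlim : Tendsto ti atTop (𝓝 t₀)) {ω : ∀ i, Motion d (ti i) T}
    (hω : ∀ i, ω i ∈ SOL f g (mi i) (hti i).2) {w : Motion d t₀ T}
    (hw : Tendsto (fun i => transfer t₀ (hti i).2 (ω i)) atTop (𝓝 w)) :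
    w ∈ SOL f g m ht₀.2 := by
  have hM := h.M_nonneg
  have hG := h.isTame hm
  have hGi := fun i => h.isTame (hmi i)
  have hlift : ∀ i, ∃ W : ℝ → Ext d, IsTraj (field f g (mi i)) M (ti i) T W ∧ ‖W (ti i)‖ ≤ 1 / 2 ∧
      ∀ t : Icc (ti i) T, (ω i t).1 = toTorus (W t).1 ∧
        (ω i t).2 - (ω i ⟨ti i, left_mem_Icc.2 (hti i).2⟩).2 = (W t).2 := by
    intro i
    obtain ⟨x, hx, hxn⟩ := exists_toTorus_eq (ω i ⟨ti i, left_mem_Icc.2 (hti i).2⟩).1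
    obtain ⟨W, hW, hWs, hcov⟩ := exists_isTraj_of_mem_SOL (hGi i) (hti i).1 (hti i).2 (hω i)
      (ξ := (x, 0)) hx
    refine ⟨W, hW, ?_, fun t => ⟨(hcov t).1, by rw [(hcov t).2, sub_zero]⟩⟩
    rw [hWs]
    exact max_le (hxn.trans (norm_torus_le _)) (by norm_num)
  choose W hW hW0 hcov using hlift
  -- The lifts are frozen before `ti i`, as in `transfer`. Their starting points have norm at most
  -- `1 / 2`, so the lifts stay in a fixed ball.
  let Y : ℕ → ℝ → Ext d := fun i τ => W i (projIcc (ti i) T (hti i).2 τ)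
  have hYcov : ∀ i, ∀ τ : Icc t₀ T, transfer t₀ (hti i).2 (ω i) τ = cover (Y i τ) := fun i τ =>
    Prod.ext (hcov i _).1 (hcov i _).2
  have hYlip : ∀ i a b, ‖Y i b - Y i a‖ ≤ M * |b - a| := fun i a b =>
    ((hW i).lip _ (projIcc (ti i) T (hti i).2 a).2 _ (projIcc (ti i) T (hti i).2 b).2).trans
      (mul_le_mul_of_nonneg_left (abs_projIcc_sub_le _ _ _) hM)
  let 𝒰 : Ultrafilter ℕ := hyperfilter ℕ
  have h𝒰 : (𝒰 : Filter ℕ) ≤ atTop := Nat.hyperfilter_le_atTop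
  have hex : ∀ τ, ∃ x : Ext d, Tendsto (fun i => Y i τ) 𝒰 (𝓝 x) := by
    intro τ
    have hmem : ∀ i, Y i τ ∈ Metric.closedBall (0 : Ext d) (1 / 2 + M * T) := fun i => by
      rw [mem_closedBall_zero_iff]
      have h1 : Y i (ti i) = W i (ti i) := by simp [Y]
      have h2 := (hW i).lip (ti i) ⟨le_rfl, (hti i).2⟩ _ (projIcc (ti i) T (hti i).2 τ).2
      have h3 := norm_le_norm_add_norm_sub' (Y i τ) (W i (ti i))
      have h4 : |(projIcc (ti i) T (hti i).2 τ : ℝ) - ti i| ≤ T := by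
        have := (projIcc (ti i) T (hti i).2 τ).2
        rw [abs_of_nonneg (sub_nonneg.2 this.1)]
        linarith [this.2, (hti i).1]
      have h5 := mul_le_mul_of_nonneg_left h4 hM
      have h6 := hW0 i
      simp only [Y] at h3 ⊢
      linarith
    obtain ⟨x, -, hx⟩ := (isCompact_closedBall (0 : Ext d) (1 / 2 + M * T)).ultrafilter_le_nhds'
      (𝒰.map fun i => Y i τ) (Filter.mem_map.2 (Eventually.of_forall hmem))
    exact ⟨x, hx⟩
  choose Z hZ using hex
  have hZcov : ∀ τ : Icc t₀ T, w τ = cover (Z τ) := by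
    intro τ
    have h1 : Tendsto (fun i => transfer t₀ (hti i).2 (ω i) τ) 𝒰 (𝓝 (w τ)) :=
      (((continuous_eval_const τ).tendsto w).comp hw).mono_left h𝒰
    simp only [hYcov] at h1
    exact tendsto_nhds_unique h1 ((continuous_cover.tendsto _).comp (hZ τ))
  have hsub : Icc t₀ T ⊆ Icc 0 T := Icc_subset_Icc_left ht₀.1
  have htraj : IsTraj (field f g m) M t₀ T Z := by
    refine isTraj_of_tendsto (l := (𝒰 : Filter ℕ)) (Gi := fun i => field f g (mi i)) (Wi := Y)
      (fun a _ b _ => ?_) (fun τ _ => hZ τ) (fun ε hε => ?_) (fun a ha ε hε => ?_)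
      fun a ha => hG.nonempty a (hsub ha) _
    · exact le_of_tendsto' ((hZ b).sub (hZ a)).norm fun i => hYlip i a b
    · refine ⟨stepSize M L (flowModulus M L δ) ε, hG.stepSize_pos hε, fun a b ha hab hb hba => ?_⟩
      -- As `a > t₀`, eventually `ti i < a` and the frozen stretch is over. This is why `IsTraj`
      -- constrains increments only after the initial time.
      filter_upwards [(hlim.mono_left h𝒰).eventually_lt_const ha] with i hi
      have ea : Y i a = W i a := by
        simp only [Y]
        rw [projIcc_of_mem (hti i).2 ⟨hi.le, hab.le.trans hb⟩]
      have eb : Y i b = W i b := by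
        simp only [Y]
        rw [projIcc_of_mem (hti i).2 ⟨hi.le.trans hab.le, hb⟩]
      rw [ea, eb]
      exact (hGi i).slope_of_isTraj (hti i).1 (hW i) hε hi.le hab.le hb hba
    · have h1 : Tendsto (fun i => L * (‖Y i a - Z a‖ + ρ i)) 𝒰 (𝓝 (L * (0 + 0))) := by
        refine Tendsto.const_mul _ (Tendsto.add ?_ (hρ0.mono_left h𝒰))
        have := (hZ a).sub_const (Z a)
        rw [sub_self] at this
        exact tendsto_zero_iff_norm_tendsto_zero.1 this
      rw [add_zero, mul_zero] at h1
      filter_upwards [h1.eventually_le_const (half_pos hε)] with i hi v hv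
      obtain ⟨v', hv', hle⟩ := h.near (ε / 2) (half_pos hε) a (hsub ha) a (hsub ha)
        (by simpa using (h.δ_pos _ (half_pos hε)).le) _ (toTorus (Z a).1) _ (m a) v hv
      refine ⟨v', hv', hle.trans ?_⟩
      have h2 : ‖toTorus (Y i a).1 - toTorus (Z a).1‖ ≤ ‖Y i a - Z a‖ :=
        (norm_toTorus_sub_le _ _).trans (norm_fst_le (Y i a - Z a))
      have h3 := mul_le_mul_of_nonneg_left (add_le_add h2 (hρ i a (hsub ha))) h.L_nonneg
      linarith
  exact mem_SOL_of_isTraj hG ht₀.1 ht₀.2 htraj hZcov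

/-! ### Passing to the limit in equilibria. -/

section Limit

variable {ti : ℕ → ℝ} {χi : ∀ i, P1 (Motion d (ti i) T)} {χt : ℕ → P1 (Motion d t₀ T)}
  {χ : P1 (Motion d t₀ T)}

/-- On `[t₀, T]` the transfer does not alter the position laws, and evaluation at a time is
`1`-Lipschitz on motions. -/
theorem W1_flow_le_of_mem {t₁ : ℝ} (ht₀ : t₀ ≤ T) (ht₁ : t₁ ≤ T) {χ₁ : P1 (Motion d t₁ T)}
    {χ₂ χ : P1 (Motion d t₀ T)} (hχ : χ₂.measure = χ₁.measure.map (transfer t₀ ht₁))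
    {τ : ℝ} (hτ : τ ∈ Icc t₀ T) : P1.W1 (flow ht₁ χ₁ τ) (flow ht₀ χ τ) ≤ P1.W1 χ₂ χ := by
  have e : flow ht₁ χ₁ τ = flow ht₀ χ₂ τ := by
    refine P1.ext_measure ?_
    have h1 := lipschitzWith_eval_fst (d := d) (projIcc t₀ T ht₀ τ)
    simp only [flow, P1.measure_map]
    rw [hχ, Measure.map_map h1.continuous.measurable (continuous_transfer t₀ ht₁).measurable]
    congr 1
    funext w
    simp [transfer, projIcc_of_mem ht₀ hτ]
  rw [e]
  exact P1.W1_map_le _ _ _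

/-- Before `t₀` the limiting flow is frozen while the other may still move, at a cost of at most `M
* |t₁ - t₀|`. -/
theorem W1_flow_le {t₁ : ℝ} (ht₀ : t₀ ≤ T) (ht₁ : t₁ ≤ T) (hM : 0 ≤ M) {χ₁ : P1 (Motion d t₁ T)}
    {χ₂ χ : P1 (Motion d t₀ T)} (hχ : χ₂.measure = χ₁.measure.map (transfer t₀ ht₁))
    (hlip : ∀ a b, P1.W1 (flow ht₁ χ₁ a) (flow ht₁ χ₁ b) ≤ M * |a - b|)
    {τ : ℝ} (hτ : τ ≤ T) :
    P1.W1 (flow ht₁ χ₁ τ) (flow ht₀ χ τ) ≤ P1.W1 χ₂ χ + M * |t₁ - t₀| := by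
  rcases le_total t₀ τ with h0 | h0
  · have := mul_nonneg hM (abs_nonneg (t₁ - t₀))
    linarith [W1_flow_le_of_mem (χ := χ) ht₀ ht₁ hχ ⟨h0, hτ⟩]
  · have e : flow ht₀ χ τ = flow ht₀ χ t₀ := by
      simp only [flow, projIcc_of_le_left ht₀ h0, projIcc_left]
    have h1 : P1.W1 (flow ht₁ χ₁ τ) (flow ht₁ χ₁ t₀) ≤ M * |t₁ - t₀| := by
      rw [← flow_projIcc ht₁ χ₁ τ, ← flow_projIcc ht₁ χ₁ t₀]
      refine (hlip _ _).trans (mul_le_mul_of_nonneg_left ?_ hM)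
      simp only [coe_projIcc, min_eq_right hτ, min_eq_right ht₀]
      rcases le_total t₀ t₁ with h2 | h2
      · rw [max_eq_left (h0.trans h2), max_eq_left h2, sub_self, abs_zero]
        exact abs_nonneg _
      · rw [max_eq_right h2, abs_sub_comm, abs_sub_comm t₁]
        have h3 : max t₁ τ ≤ t₀ := max_le h2 h0
        rw [abs_of_nonneg (sub_nonneg.2 h3), abs_of_nonneg (sub_nonneg.2 h2)]
        linarith [le_max_left t₁ τ]
    have h2 := W1_flow_le_of_mem (χ := χ) ht₀ ht₁ hχ ⟨le_rfl, ht₀⟩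
    have h3 := dist_triangle (flow ht₁ χ₁ τ) (flow ht₁ χ₁ t₀) (flow ht₀ χ t₀)
    rw [e]
    change P1.W1 _ _ ≤ P1.W1 _ _ + P1.W1 _ _ at h3
    linarith

/-- Limits of equilibria are equilibria. -/
theorem IsEquilibrium.of_tendsto (h : VectogramBounds f g T M L δ)
    (hσ : Continuous fun p : Torus d × P1 (Torus d) => σ p.1 p.2)
    {ϰ : ℝ} (hϰ : 0 ≤ ϰ) (hσϰ : ∀ x' x'' m, |σ x' m - σ x'' m| ≤ ϰ * ‖x' - x''‖)
    (ht₀ : t₀ ∈ Icc 0 T) (hti : ∀ i, ti i ∈ Icc 0 T) (hlim : Tendsto ti atTop (𝓝 t₀))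
    (hχi : ∀ i, IsEquilibrium f g σ M (hti i).2 (χi i))
    (hχt : ∀ i, (χt i).measure = (χi i).measure.map (transfer t₀ (hti i).2))
    (hχ : Tendsto (fun i => P1.W1 (χt i) χ) atTop (𝓝 0)) : IsEquilibrium f g σ M ht₀.2 χ := by
  have hM := h.M_nonneg
  set m := flow ht₀.2 χ with hm_def
  let ρ : ℕ → ℝ := fun i => P1.W1 (χt i) χ + M * |ti i - t₀|
  have hρ0 : Tendsto ρ atTop (𝓝 0) := by
    have := hχ.add (((hlim.sub_const t₀).abs).const_mul M)
    simpa using this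
  have hρ : ∀ i, ∀ τ ∈ Icc 0 T, P1.W1 (flow (hti i).2 (χi i) τ) (m τ) ≤ ρ i := fun i τ hτ =>
    W1_flow_le ht₀.2 (hti i).2 hM (hχt i) (hχi i).lip hτ.2
  have hlip : ∀ a b, P1.W1 (m a) (m b) ≤ M * |a - b| := by
    -- The flows are compared only on `[0, T]`; the bound for all real times then follows since
    -- `flow` is frozen outside `[t₀, T]`.
    have key : ∀ a ∈ Icc 0 T, ∀ b ∈ Icc 0 T, P1.W1 (m a) (m b) ≤ M * |a - b| := by
      intro a ha b hb
      have h1 : Tendsto (fun i => ρ i + M * |a - b| + ρ i) atTop (𝓝 (0 + M * |a - b| + 0)) :=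
        (hρ0.add_const _).add hρ0
      rw [zero_add, add_zero] at h1
      refine ge_of_tendsto' h1 fun i => ?_
      have h2 := dist_triangle4 (m a) (flow (hti i).2 (χi i) a) (flow (hti i).2 (χi i) b) (m b)
      have h3 := hρ i a ha
      have h4 := hρ i b hb
      have h5 := (hχi i).lip a b
      rw [dist_comm (m a) (flow (hti i).2 (χi i) a)] at h2
      change P1.W1 _ _ ≤ P1.W1 _ _ + P1.W1 _ _ + P1.W1 _ _ at h2
      linarith
    intro a b
    have hsub : Icc t₀ T ⊆ Icc 0 T := Icc_subset_Icc_left ht₀.1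
    have := key _ (hsub (projIcc t₀ T ht₀.2 a).2) _ (hsub (projIcc t₀ T ht₀.2 b).2)
    rw [hm_def, flow_projIcc, flow_projIcc] at this
    exact this.trans (mul_le_mul_of_nonneg_left (abs_projIcc_sub_le _ _ _) hM)
  -- Motions in the limiting support are limits of transferred motions from the approximating
  -- supports.
  have hextract : ∀ w ∈ χ.measure.support, ∃ (k : ℕ → ℕ) (ω : ∀ n, Motion d (ti (k n)) T),
      Tendsto k atTop atTop ∧ (∀ n, ω n ∈ (χi (k n)).measure.support) ∧
      Tendsto (fun n => transfer t₀ (hti (k n)).2 (ω n)) atTop (𝓝 w) := by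
    intro w hw
    have h1 : ∀ n : ℕ, ∃ i ≥ n, ∃ ω ∈ (χi i).measure.support,
        dist (transfer t₀ (hti i).2 ω) w < 1 / ((n : ℝ) + 1) := fun n =>
      ((eventually_ge_atTop n).and (P1.eventually_exists_dist_lt hχ hw
        (fun i => (continuous_transfer t₀ (hti i).2).measurable) hχt
        (fun i => Measure.support_mem_ae) Nat.one_div_pos_of_nat)).exists
    choose k hk ω hω hdist using h1
    refine ⟨k, ω, tendsto_atTop_mono hk tendsto_id, hω, ?_⟩
    rw [tendsto_iff_dist_tendsto_zero]
    exact squeeze_zero (fun _ => dist_nonneg) (fun n => (hdist n).le)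
      tendsto_one_div_add_atTop_nhds_zero_nat
  refine ⟨hlip, fun w hw => ?_, fun s r w hw => ?_⟩
  · obtain ⟨k, ω, hk, hω, hconv⟩ := hextract w hw
    exact h.mem_SOL_of_tendsto hlip (fun i => (hχi (k i)).lip) (fun i => hρ (k i)) (hρ0.comp hk) ht₀
      (fun i => hti (k i)) (hlim.comp hk) (fun n => (hχi (k n)).supp (hω n)) hconv
  · obtain ⟨k, ω, hk, hω, hconv⟩ := hextract w hw
    -- A transferred motion at time `s` shows the original at the projection of `s` to `[ti (k n),
    -- T]`. Evaluating the value function at that projected time keeps the identity exact for every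
    -- `n`, and these times tend to `s`.
    have key : ∀ s : Icc t₀ T, Tendsto (fun n =>
        value f g σ M T (flow (hti (k n)).2 (χi (k n))) (projIcc (ti (k n)) T (hti (k n)).2 s)
          (transfer t₀ (hti (k n)).2 (ω n) s).1 + (transfer t₀ (hti (k n)).2 (ω n) s).2) atTop
        (𝓝 (value f g σ M T m s (w s).1 + (w s).2)) := by
      intro s
      have hev : Tendsto (fun n => transfer t₀ (hti (k n)).2 (ω n) s) atTop (𝓝 (w s)) :=
        ((continuous_eval_const s).tendsto w).comp hconv
      refine Tendsto.add ?_ ((continuous_snd.tendsto _).comp hev)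
      have hs0 : (s : ℝ) ∈ Icc 0 T := ⟨ht₀.1.trans s.2.1, s.2.2⟩
      have hproj : Tendsto (fun n => (projIcc (ti (k n)) T (hti (k n)).2 s : ℝ)) atTop (𝓝 s) := by
        have h1 := ((hlim.comp hk).max (tendsto_const_nhds (x := (s : ℝ))))
        rw [max_eq_right s.2.1] at h1
        refine h1.congr fun n => ?_
        simp [coe_projIcc, min_eq_right s.2.2]
      rw [Metric.tendsto_nhds]
      intro ε hε
      have h1 := eventually_abs_value_sub_value_le h hσ hϰ hσϰ hlip
        (fun n => (hχi (k n)).lip) (fun n => hρ (k n)) (hρ0.comp hk) hs0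
        (fun n => Icc_subset_Icc_left (hti (k n)).1 (projIcc (ti (k n)) T (hti (k n)).2 s).2) hproj
        (half_pos hε)
      have h2 : Tendsto (fun n => valueLip ϰ M L T *
          ‖(w s).1 - (transfer t₀ (hti (k n)).2 (ω n) s).1‖) atTop (𝓝 0) := by
        have h3 : Tendsto (fun n => (transfer t₀ (hti (k n)).2 (ω n) s).1) atTop (𝓝 (w s).1) :=
          (continuous_fst.tendsto _).comp hev
        have := (tendsto_zero_iff_norm_tendsto_zero.1
          (by simpa using h3.const_sub (w s).1)).const_mul (valueLip ϰ M L T)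
        simpa using this
      filter_upwards [h1, h2.eventually_lt_const (half_pos hε)] with n hn1 hn2
      rw [Real.dist_eq]
      linarith [hn1 (w s).1 (transfer t₀ (hti (k n)).2 (ω n) s).1]
    refine tendsto_nhds_unique (key s) ((key r).congr fun n => ?_)
    -- The constant subtracted from `z` by `transfer` occurs on both sides and cancels.
    have := (hχi (k n)).const (projIcc (ti (k n)) T (hti (k n)).2 r)
      (projIcc (ti (k n)) T (hti (k n)).2 s) (ω n) (hω n)
    simp only [transfer, ContinuousMap.coe_mk]
    linarith

end Limit

/-- Any sequence of distributions of motions concentrated on solutions has, after transfer to a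
common time interval, a convergent subsequence. -/
theorem exists_subseq_transfer (h : VectogramBounds f g T M L δ) (t₀ : ℝ) {ti : ℕ → ℝ}
    (hti : ∀ i, ti i ∈ Icc 0 T) {χi : ∀ i, P1 (Motion d (ti i) T)}
    (hχi : ∀ i, IsEquilibrium f g σ M (hti i).2 (χi i)) :
    ∃ (χt : ℕ → P1 (Motion d t₀ T)) (χ : P1 (Motion d t₀ T)) (k : ℕ → ℕ), StrictMono k ∧
      (∀ i, (χt i).measure = (χi i).measure.map (transfer t₀ (hti i).2)) ∧
      Tendsto (fun i => P1.W1 (χt (k i)) χ) atTop (𝓝 0) := by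
  have hM := h.M_nonneg
  -- Normalizing `z` at time `ti i` gives `|z| ≤ M * T`; otherwise the laws of `z` could escape to
  -- infinity.
  set K := lipMotions d t₀ T M (M * T)
  have hKc : IsCompact K := isCompact_lipMotions _
  have : CompactSpace K := isCompact_iff_compactSpace.1 hKc
  have hmaps : ∀ i, ∀ w ∈ (χi i).measure.support, transfer t₀ (hti i).2 w ∈ K := by
    intro i w hw
    have hd := h.dist_le_of_mem_SOL (hti i).1 (hti i).2 ((hχi i).supp hw)
    refine ⟨fun a b => ?_, fun a => ?_⟩
    · have h1 := hd (projIcc (ti i) T (hti i).2 a) (projIcc (ti i) T (hti i).2 b)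
      have h2 := mul_le_mul_of_nonneg_left (abs_projIcc_sub_le (hti i).2 (a : ℝ) b) hM
      refine le_trans ?_ (h1.trans h2)
      rw [Prod.dist_eq, Prod.dist_eq]
      simp [transfer, Real.dist_eq]
    · have h1 := hd (projIcc (ti i) T (hti i).2 a) ⟨ti i, left_mem_Icc.2 (hti i).2⟩
      have h2 := (le_max_right _ _).trans h1
      rw [Real.dist_eq] at h2
      refine h2.trans (mul_le_mul_of_nonneg_left ?_ hM)
      have := (projIcc (ti i) T (hti i).2 (a : ℝ)).2
      rw [abs_of_nonneg (sub_nonneg.2 this.1)]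
      linarith [this.2, (hti i).1]
  let μ : ℕ → Measure (Motion d t₀ T) := fun i => (χi i).measure.map (transfer t₀ (hti i).2)
  have hmeas : ∀ i, Measurable (transfer t₀ (hti i).2 : Motion d (ti i) T → Motion d t₀ T) :=
    fun i => (continuous_transfer t₀ (hti i).2).measurable
  have hKm : MeasurableSet K := hKc.isClosed.measurableSet
  have hμK : ∀ i, μ i Kᶜ = 0 := by
    intro i
    rw [Measure.map_apply (hmeas i) hKm.compl]
    refine measure_mono_null ?_ (Measure.measure_compl_support (μ := (χi i).measure))
    exact fun w hw hw' => hw (hmaps i w hw')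
  -- The laws live on `K`: they are pulled back to this compact space, a subsequence is extracted
  -- there, and the inclusion carries it back without increasing `W1`.
  have hrestrict : ∀ i, (Measure.comap ((↑) : K → Motion d t₀ T) (μ i)).map (↑) = μ i := by
    intro i
    rw [map_comap_subtype_coe hKm, Measure.restrict_eq_self_of_ae_mem]
    exact mem_ae_iff.2 (hμK i)
  have hprob : ∀ i, IsProbabilityMeasure (Measure.comap ((↑) : K → Motion d t₀ T) (μ i)) := by
    intro i
    have hp : IsProbabilityMeasure (μ i) :=
      Measure.isProbabilityMeasure_map (hmeas i).aemeasurable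
    refine ⟨?_⟩
    have h1 := hp.measure_univ
    rw [← hrestrict i, Measure.map_apply measurable_subtype_coe MeasurableSet.univ] at h1
    exact h1
  let ν : ℕ → P1 K := fun i => P1.ofProb ⟨_, hprob i⟩
  obtain ⟨ν₀, k, hk, hconv⟩ := P1.exists_subseq_tendsto ν
  have hval : LipschitzWith 1 ((↑) : K → Motion d t₀ T) := LipschitzWith.subtype_val _
  refine ⟨fun i => (ν i).map hval, ν₀.map hval, k, hk, fun i => ?_, ?_⟩
  · rw [P1.measure_map]
    exact hrestrict i
  · exact squeeze_zero (fun i => dist_nonneg (x := (ν (k i)).map hval) (y := ν₀.map hval))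
      (fun i => P1.W1_map_le hval _ _) hconv

/-- Compactness of the set of solutions of the mean field game. -/
theorem exists_subseq_isSolution (h : VectogramBounds f g T M L δ)
    (hσ : Continuous fun p : Torus d × P1 (Torus d) => σ p.1 p.2)
    {ϰ : ℝ} (hϰ : 0 ≤ ϰ) (hσϰ : ∀ x' x'' m, |σ x' m - σ x'' m| ≤ ϰ * ‖x' - x''‖)
    (ht₀ : t₀ ∈ Icc 0 T) {ti : ℕ → ℝ} (hti : ∀ i, ti i ∈ Icc 0 T)
    (hlim : Tendsto ti atTop (𝓝 t₀)) {Vi : ℕ → ℝ → Torus d → ℝ} {mi : ℕ → ℝ → P1 (Torus d)}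
    (hVi : ∀ i, IsSolution f g σ T (ti i) (hti i).2 (Vi i) (mi i)) :
    ∃ (V : ℝ → Torus d → ℝ) (m : ℝ → P1 (Torus d)) (k : ℕ → ℕ), StrictMono k ∧
      IsSolution f g σ T t₀ ht₀.2 V m ∧ Tendsto (fun i => mi (k i) (ti (k i))) atTop (𝓝 (m t₀)) ∧
      TendstoUniformly (fun i => Vi (k i) (ti (k i))) (V t₀) atTop := by
  choose χi hχi hmi hval using fun i => (hVi i).exists_isEquilibrium h (hti i)
  obtain ⟨χt, χ, k, hk, hχt, hconv⟩ := exists_subseq_transfer h t₀ hti hχi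
  have hlimk := hlim.comp hk.tendsto_atTop
  have hχ : IsEquilibrium f g σ M ht₀.2 χ := IsEquilibrium.of_tendsto h hσ hϰ hσϰ ht₀
    (fun i => hti (k i)) hlimk (fun i => hχi (k i)) (fun i => hχt (k i)) hconv
  have hρ0 : Tendsto (fun i => P1.W1 (χt (k i)) χ + M * |ti (k i) - t₀|) atTop (𝓝 0) := by
    have := hconv.add (((hlimk.sub_const t₀).abs).const_mul M)
    simpa using this
  have hρ : ∀ i, ∀ τ ∈ Icc 0 T, P1.W1 (flow (hti (k i)).2 (χi (k i)) τ) (flow ht₀.2 χ τ) ≤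
      P1.W1 (χt (k i)) χ + M * |ti (k i) - t₀| := fun i τ hτ =>
    W1_flow_le ht₀.2 (hti (k i)).2 h.M_nonneg (hχt (k i)) (hχi (k i)).lip hτ.2
  refine ⟨_, _, k, hk, hχ.isSolution h hσ hϰ hσϰ ht₀, ?_, ?_⟩
  · simp only [hmi]
    rw [tendsto_iff_dist_tendsto_zero]
    have h1 : Tendsto (fun i => (P1.W1 (χt (k i)) χ + M * |ti (k i) - t₀|) +
        M * |ti (k i) - t₀|) atTop (𝓝 0) := by
      have := hρ0.add (((hlimk.sub_const t₀).abs).const_mul M)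
      simpa using this
    refine squeeze_zero (fun _ => dist_nonneg) (fun i => ?_) h1
    exact (dist_triangle _ (flow ht₀.2 χ (ti (k i))) _).trans
      (add_le_add (hρ i _ (hti (k i))) (hχ.lip _ _))
  · rw [Metric.tendstoUniformly_iff]
    intro ε hε
    have h1 := eventually_abs_value_sub_value_le h hσ hϰ hσϰ hχ.lip (fun i => (hχi (k i)).lip) hρ hρ0
      ht₀ (fun i => hti (k i)) hlimk (half_pos hε)
    filter_upwards [h1] with i hi y
    have := hi y y
    rw [sub_self, norm_zero, mul_zero, zero_add] at this
    rw [dist_comm, Real.dist_eq, hval (k i) _ ⟨le_rfl, (hti (k i)).2⟩]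
    linarith

end Flow

/-! ### The closure of a realized multifunction. -/

section Closure

variable {d : ℕ} {U : Type*} {T : ℝ}
  {f : ℝ → Torus d → P1 (Torus d) → U → (Fin d → ℝ)}
  {g : ℝ → Torus d → P1 (Torus d) → U → ℝ}
  {σ : Torus d → P1 (Torus d) → ℝ}
  {𝒱 : Icc (0 : ℝ) T × P1 (Torus d) → Set C(Torus d, ℝ)}

/-- The graph of the closure of a multifunction is the closure of its graph. -/
theorem graph_closureMultifunction :
    {q : (Icc (0 : ℝ) T × P1 (Torus d)) × C(Torus d, ℝ) | q.2 ∈ closureMultifunction 𝒱 q.1} =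
      closure {q | q.2 ∈ 𝒱 q.1} := by
  ext ⟨⟨t, m⟩, φ⟩
  rw [mem_closure_iff_seq_limit]
  constructor
  · rintro ⟨ti, mi, ψ, hψ, ht, hm, hφ⟩
    exact ⟨fun i => ((ti i, mi i), ψ i), hψ,
      (ht.prodMk_nhds hm).prodMk_nhds (tendsto_iff_norm_sub_tendsto_zero.2 hφ)⟩
  · rintro ⟨x, hx, hlim⟩
    have h1 := (continuous_fst.tendsto _).comp hlim
    exact ⟨fun i => (x i).1.1, fun i => (x i).1.2, fun i => (x i).2, hx,
      (continuous_fst.tendsto _).comp h1, (continuous_snd.tendsto _).comp h1,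
      tendsto_iff_norm_sub_tendsto_zero.1 ((continuous_snd.tendsto _).comp hlim)⟩

/-- Compactness of solutions in terms of multifunctions. Convergence of `ψ` is a conclusion, not a
hypothesis, which is what upper semicontinuity needs. -/
theorem exists_subseq_of_isRealized [MetricSpace U] [CompactSpace U] [Nonempty U]
    (hfgσ : Assumptions T f g σ) (h𝒱 : IsRealized f g σ T 𝒱)
    {t : ℕ → Icc (0 : ℝ) T} {m : ℕ → P1 (Torus d)} {ψ : ℕ → C(Torus d, ℝ)}
    (hψ : ∀ i, ψ i ∈ 𝒱 (t i, m i)) {t₀ : Icc (0 : ℝ) T} {m₀ : P1 (Torus d)}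
    (ht : Tendsto t atTop (𝓝 t₀)) (hm : Tendsto m atTop (𝓝 m₀)) :
    ∃ (V : ℝ → Torus d → ℝ) (n : ℝ → P1 (Torus d)) (φ : C(Torus d, ℝ)) (k : ℕ → ℕ),
      StrictMono k ∧ IsSolution f g σ T t₀ t₀.2.2 V n ∧ (∀ x, V t₀ x = φ x) ∧ n t₀ = m₀ ∧
      Tendsto (fun i => ψ (k i)) atTop (𝓝 φ) := by
  obtain ⟨M, L, δ, hb⟩ := hfgσ.exists_vectogramBounds
  obtain ⟨ϰ₀, hϰ₀⟩ := hfgσ.lipschitz_σ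
  choose Vi mi hsol hVi hmi using fun i => h𝒱 (t i) (m i) (ψ i) (hψ i)
  obtain ⟨V, n, k, hk, hV, hn, hlim⟩ := exists_subseq_isSolution hb hfgσ.continuous_σ
    (le_max_right ϰ₀ 0) (fun x' x'' m => (hϰ₀ x' x'' m).trans
      (mul_le_mul_of_nonneg_right (le_max_left _ _) (norm_nonneg _))) t₀.2 (fun i => (t i).2)
    ((continuous_subtype_val.tendsto t₀).comp ht) hsol
  have hVc : Continuous fun x => V t₀ x := by
    have hι : Continuous fun x : Torus d => ((t₀ : ℝ), x) := by fun_prop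
    exact hV.1.comp_continuous hι fun x => ⟨⟨le_rfl, t₀.2.2⟩, mem_univ _⟩
  refine ⟨V, n, ⟨_, hVc⟩, k, hk, hV, fun _ => rfl, ?_, ?_⟩
  · simp only [hmi] at hn
    exact tendsto_nhds_unique hn (hm.comp hk.tendsto_atTop)
  · rw [ContinuousMap.tendsto_iff_tendstoUniformly]
    have e : (fun i x => ψ (k i) x) = fun i => Vi (k i) (t (k i)) := by
      funext i x
      exact (hVi (k i) x).symm
    rw [show (fun i => (ψ (k i) : Torus d → ℝ)) = fun i => Vi (k i) (t (k i)) from e]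
    exact hlim

/-- The prescribed limit `φ` coincides with the subsequential limit, which is the initial value of a
solution. -/
theorem IsRealized.closureMultifunction [MetricSpace U] [CompactSpace U] [Nonempty U]
    (hfgσ : Assumptions T f g σ) (h𝒱 : IsRealized f g σ T 𝒱) :
    IsRealized f g σ T (closureMultifunction 𝒱) := by
  rintro t₀ m₀ φ ⟨t, m, ψ, hψ, ht, hm, hφ⟩
  obtain ⟨V, n, φ', k, hk, hV, hVφ, hn, hlim⟩ := exists_subseq_of_isRealized hfgσ h𝒱 hψ ht hm
  have : φ' = φ := tendsto_nhds_unique hlim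
    ((tendsto_iff_norm_sub_tendsto_zero.2 hφ).comp hk.tendsto_atTop)
  exact ⟨V, n, hV, this ▸ hVφ, hn⟩

/-- A realized multifunction with closed graph is upper semicontinuous. -/
theorem IsRealized.upperHemicontinuous [MetricSpace U] [CompactSpace U] [Nonempty U]
    (hfgσ : Assumptions T f g σ) (h𝒱 : IsRealized f g σ T 𝒱)
    (hcl : IsClosed {q : (Icc (0 : ℝ) T × P1 (Torus d)) × C(Torus d, ℝ) | q.2 ∈ 𝒱 q.1}) :
    UpperHemicontinuous 𝒱 := by
  rw [upperHemicontinuous_iff]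
  intro p
  rw [upperHemicontinuousAt_iff_forall_isOpen]
  intro O hO hpO
  -- A closed graph alone would not suffice, as the escaping functions need not accumulate anywhere;
  -- being realized supplies a convergent subsequence, whose limit lies in `𝒱 p ⊆ O`.
  by_contra hcon
  rw [not_eventually] at hcon
  obtain ⟨q, hq, hqO⟩ := exists_seq_forall_of_frequently hcon
  have hex : ∀ i, ∃ ψ ∈ 𝒱 (q i), ψ ∉ O := fun i => not_subset.1 (hqO i)
  choose ψ hψ hψO using hex
  obtain ⟨V, n, φ, k, hk, -, -, -, hlim⟩ := exists_subseq_of_isRealized hfgσ h𝒱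
    (t := fun i => (q i).1) (m := fun i => (q i).2) hψ ((continuous_fst.tendsto _).comp hq)
    ((continuous_snd.tendsto _).comp hq)
  have hφ : φ ∈ 𝒱 p := hcl.mem_of_tendsto ((hq.comp hk.tendsto_atTop).prodMk_nhds hlim)
    (Eventually.of_forall fun i => hψ (k i))
  obtain ⟨i, hi⟩ := (hlim.eventually (hO.mem_nhds (hpO hφ))).exists
  exact hψO _ hi

end Closure

end MFG

end

theorem mainTheorem5 {d : ℕ} {U : Type*} [MetricSpace U] [CompactSpace U] [Nonempty U]
    (T : ℝ) (hT : 0 ≤ T)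
    (f : ℝ → MFG.Torus d → MFG.P1 (MFG.Torus d) → U → (Fin d → ℝ))
    (g : ℝ → MFG.Torus d → MFG.P1 (MFG.Torus d) → U → ℝ)
    (σ : MFG.Torus d → MFG.P1 (MFG.Torus d) → ℝ)
    (hfgσ : MFG.Assumptions T f g σ)
    (𝒱 : Set.Icc (0 : ℝ) T × MFG.P1 (MFG.Torus d) → Set C(MFG.Torus d, ℝ))
    (h𝒱 : MFG.IsRealized f g σ T 𝒱) :
    MFG.IsValueMultifunction f g σ T (MFG.closureMultifunction 𝒱) := by
  have hcl : IsClosed {q : (Set.Icc (0 : ℝ) T × MFG.P1 (MFG.Torus d)) × C(MFG.Torus d, ℝ) |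
      q.2 ∈ MFG.closureMultifunction 𝒱 q.1} := by
    rw [MFG.graph_closureMultifunction]
    exact isClosed_closure
  have hreal := MFG.IsRealized.closureMultifunction hfgσ h𝒱
  exact ⟨⟨MFG.IsRealized.upperHemicontinuous hfgσ hreal hcl, hcl⟩, hreal⟩
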